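/- **Bianchi permutability of Darboux transforms in $\mathbb{R}^n$.** *Conventions.* Let $C\ell_n$ be the Clifford algebra of Euclidean $\mathbb{R}^n$ with $v^2=-(v,v)$ for $v\in\mathbb{R}^n$; so a non-zero vector $v$ is invertible in $C\ell_n$. For $\mathbb{R}^n$-valued 1-forms put $(\alpha\wedge\beta)(X,Y)=\alpha(X)\beta(Y)-\alpha(Y)\beta(X)\in C\ell_n$. Let $(M,Q)$ be a polarised Riemann surface: a connected Riemann surface $M$ with a holomorphic quadratic differential $Q\not\equiv 0$. All maps are smooth ($C^\infty$ in the real sense). For an open set $U\subseteq M$ and a map $f:U\to\mathbb{R}^n$: - $f^c:U\to\mathbb{R}^n$ is a *Christoffel transform* of $f$ if $df\wedge df^c=0$ and $(df,df^c)^{2,0}=Q$ on $U$. - $f$ is *isothermic* on $(U,Q)$ if it is a conformal immersion that has a Christoffel transform. - For $r\in\mathbb{R}\setminus\{0\}$, $\hat f:U\to\mathbb{R}^n$ is a *Darboux transform* of $f$ with parameter $r$, written $\hat f=\mathcal{D}_r f$ on $U$, if for some Christoffel transform $f^c$ of $f$ the map $g=\hat f-f$ is nowhere zero and solves the Riccati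 equation $dg=r\,g\,df^c\,g-df$ in $C\ell_n$. (Here $f$ may fail to be immersed at zeros of $Q$.) The Clifford algebra cross-ratio of $v_0,v_1,v_2,v_3\in\mathbb{R}^n$ with $v_1\ne v_2$, $v_0\neq v_3$ is $$C(v_0,v_1,v_2,v_3)=(v_1-v_0)(v_2-v_1)^{-1}(v_2-v_3)(v_3-v_0)^{-1}\in C\ell_n .$$ Points are *concircular* if they lie on a round circle or on a straight line. **Theorem.** Let $f:(M,Q)\to\mathbb{R}^n$ be isothermic, let $r_1,r_2\in\mathbb{R}\setminus\{0\}$, and let $f_1=\mathcal{D}_{r_1}f$ and $f_2=\mathcal{D}_{r_2}f$ be Darboux transforms of $f$ on $M$ with $f_1\neq f_2$ (as maps). Put $g_i=f_i-f$ and $$U=\{p\in M:\ f_1(p)\neq f_2(p)\ \text{ and }\ r_2g_1(p)^{-1}-r_1g_2(p)^{-1}\neq 0\}.$$ Then $U$ is open and dense in $M$, and there is an $\mathbb{R}^n$-valued map $\hat f$ on $U$ that is isothermic on $(U,Q)$ and satisfies $$\hat f=\mathcal{D}_{r_2}f_1=\mathcal{D}_{r_1}f_2\quad\text{on } U .$$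 It is given by $$\hat f=\bigl(r_2f_1g_1^{-1}-r_1f_2g_2^{-1}\bigr)\bigl(r_2g_1^{-1}-r_1g_2^{-1}\bigr)^{-1},$$ and at every point of $U$ the points $f,f_1,\hat f,f_2$ are concircular with $$C(f,f_1,\hat f,f_2)=\frac{r_2}{r_1}.$$ -/

import Mathlib

open scoped Manifold ContDiff InnerProductSpace

noncomputable section

namespace Isothermic

/-! ### Clifford algebra of Euclidean space -/

/-- Euclidean `n`-space. -/
abbrev E (n : ℕ) : Type := EuclideanSpace ℝ (Fin n)

/-- The negative definite quadratic form `v ↦ -⟪v, v⟫` on Euclidean `n`-space. -/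
def negForm (n : ℕ) : QuadraticForm ℝ (E n) :=
  -(LinearMap.BilinMap.toQuadraticMap (innerₗ (E n)))

/-- The form is `v ↦ -‖v‖ ^ 2`. -/
theorem negForm_apply (n : ℕ) (v : E n) : negForm n v = -‖v‖ ^ 2 := by
  simp [negForm]

/-- The Clifford algebra `Cl_n`, in which `v * v = -⟪v, v⟫` for vectors `v`. -/
abbrev Cl (n : ℕ) : Type := CliffordAlgebra (negForm n)

/-- The inclusion of Euclidean space in its Clifford algebra. -/
def vec {n : ℕ} (v : E n) : Cl n := CliffordAlgebra.ι (negForm n) v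

/-- The Clifford relation. -/
theorem vec_mul_self {n : ℕ} (v : E n) :
    vec v * vec v = algebraMap ℝ (Cl n) (-‖v‖ ^ 2) := by
  rw [vec, CliffordAlgebra.ι_sq_scalar, negForm_apply]

/-- The inverse in the Clifford algebra of a vector (`0` if the vector is zero). -/
def vinv {n : ℕ} (v : E n) : Cl n := Ring.inverse (vec v)

/-- The Clifford algebra cross-ratio
`(v₁ - v₀) (v₂ - v₁)⁻¹ (v₂ - v₃) (v₃ - v₀)⁻¹` of four points of Euclidean space. -/
def crossRatio {n : ℕ} (v₀ v₁ v₂ v₃ : E n) : Cl n :=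
  vec (v₁ - v₀) * vinv (v₂ - v₁) * vec (v₂ - v₃) * vinv (v₃ - v₀)

/-- A set of points is concircular if it lies on a circle of Möbius geometry,
that is, on a round circle or on a straight line. -/
def Concircular {n : ℕ} (S : Set (E n)) : Prop :=
  EuclideanGeometry.Concyclic S ∨ Collinear ℝ S

/-! ### Quadratic differentials and isothermic surfaces

Throughout, `M` is a Riemann surface, that is, a complex manifold modelled on `ℂ`.  Its tangent
space at `p` is (by definition in Mathlib) the model space `ℂ`, identified by means of the
preferred chart at `p`; the complex structure is multiplication by `Complex.I`. -/

/-- A holomorphic quadratic differential on a Riemann surface: a field of `ℂ`-bilinear forms on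
the (complex one-dimensional) tangent spaces, which in each chart `z` reads `q dz ^ 2` with `q`
holomorphic. -/
structure QuadraticDifferential (M : Type*) [TopologicalSpace M] [ChartedSpace ℂ M] where
  /-- The bilinear form at a point. -/
  form : (p : M) →
    TangentSpace 𝓘(ℂ, ℂ) p →L[ℂ] TangentSpace 𝓘(ℂ, ℂ) p →L[ℂ] ℂ
  /-- The coefficient is holomorphic in charts. -/
  holomorphic : ∀ p₀ : M, DifferentiableOn ℂ
    (fun z : ℂ =>
      form ((chartAt ℂ p₀).symm z)
        (mfderiv 𝓘(ℂ, ℂ) 𝓘(ℂ, ℂ) (chartAt ℂ p₀).symm z (1 : ℂ))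
        (mfderiv 𝓘(ℂ, ℂ) 𝓘(ℂ, ℂ) (chartAt ℂ p₀).symm z (1 : ℂ)))
    (chartAt ℂ p₀).target

section Surfaces

variable {M : Type*} [TopologicalSpace M] [ChartedSpace ℂ M] {n : ℕ}

/-- The value of a quadratic differential on a tangent vector. -/
def QuadraticDifferential.eval (Q : QuadraticDifferential M) (p : M) (X : ℂ) : ℂ :=
  Q.form p X X

/-- A map into Euclidean space is smooth (in the real sense) on `U`. -/
def SmoothOn (f : M → E n) (U : Set M) : Prop :=
  ContMDiffOn 𝓘(ℝ, ℂ) 𝓘(ℝ, E n) ∞ f U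

/-- The real differential `d f` at `p`. -/
def diff (f : M → E n) (p : M) : ℂ →L[ℝ] E n :=
  mfderiv 𝓘(ℝ, ℂ) 𝓘(ℝ, E n) f p

/-- The `(2,0)`-part `(df, dh)^{2,0}`, as a function of a tangent vector `X`: the value of the
complex bilinear extension of `(df, dh)` on the pair `(Z, Z)`, where `Z = (X - i J X) / 2` is the
vector of type `(1,0)` that corresponds to `X`.  In a holomorphic coordinate `z` it is
`(f_z, h_z) dz ^ 2`. -/
def twoZeroPart (f h : M → E n) (p : M) (X : ℂ) : ℂ :=
  (1 / 4 : ℂ) *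
    (((⟪diff f p X, diff h p X⟫_ℝ
        - ⟪diff f p (Complex.I * X), diff h p (Complex.I * X)⟫_ℝ : ℝ) : ℂ)
      - Complex.I *
        ((⟪diff f p X, diff h p (Complex.I * X)⟫_ℝ
          + ⟪diff f p (Complex.I * X), diff h p X⟫_ℝ : ℝ) : ℂ))

/-- The value on `(X, Y)` of the Clifford algebra valued two-form `df ∧ dh`. -/
def wedge (f h : M → E n) (p : M) (X Y : ℂ) : Cl n :=
  vec (diff f p X) * vec (diff h p Y) - vec (diff f p Y) * vec (diff h p X)

/-- `f` is a smooth conformal immersion of the open set `U`. -/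
def IsConformalImmersionOn (f : M → E n) (U : Set M) : Prop :=
  SmoothOn f U ∧ ∀ p ∈ U,
    Function.Injective (diff f p) ∧ ∀ X : ℂ, twoZeroPart f f p X = 0

/-- `fc` is a Christoffel transform of `f` on the open set `U`, with respect to the polarisation
`Q`: the maps are smooth with `df ∧ dfc = 0` and `(df, dfc)^{2,0} = Q`.
It is not required here that `f` be immersed. -/
def IsChristoffelOn (Q : QuadraticDifferential M) (f fc : M → E n) (U : Set M) : Prop :=
  SmoothOn f U ∧ SmoothOn fc U ∧ ∀ p ∈ U,
    (∀ X Y : ℂ, wedge f fc p X Y = 0) ∧ ∀ X : ℂ, twoZeroPart f fc p X = Q.eval p X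

/-- `f` is isothermic on the open set `U` with its polarisation `Q`: it is a conformal immersion
that has a Christoffel transform. -/
def IsIsothermicOn (Q : QuadraticDifferential M) (f : M → E n) (U : Set M) : Prop :=
  IsConformalImmersionOn f U ∧ ∃ fc : M → E n, IsChristoffelOn Q f fc U

/-- `f' = 𝒟_r f` on the open set `U`: for a Christoffel transform `fc` of `f` with respect to `Q`,
the difference `g = f' - f` is nowhere zero and solves the Riccati equation
`dg = r g dfc g - df`, with all products taken in the Clifford algebra. -/
def IsDarbouxOn (Q : QuadraticDifferential M) (r : ℝ) (f f' : M → E n) (U : Set M) : Prop :=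
  ∃ fc : M → E n, IsChristoffelOn Q f fc U ∧ SmoothOn f' U ∧
    ∀ p ∈ U, f' p - f p ≠ 0 ∧ ∀ X : ℂ,
      vec (diff (fun q => f' q - f q) p X) =
        r • (vec (f' p - f p) * vec (diff fc p X) * vec (f' p - f p)) - vec (diff f p X)

/-- The denominator `r₂ g₁⁻¹ - r₁ g₂⁻¹` in the formula for the fourth surface, where
`gᵢ = fᵢ - f`. -/
def bianchiDenom (r₁ r₂ : ℝ) (f f₁ f₂ : M → E n) (p : M) : Cl n :=
  r₂ • vinv (f₁ p - f p) - r₁ • vinv (f₂ p - f p)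

/-- The points at which `f₁` and `f₂` are distinct and `r₂ g₁⁻¹ - r₁ g₂⁻¹` does not vanish. -/
def bianchiDomain (r₁ r₂ : ℝ) (f f₁ f₂ : M → E n) : Set M :=
  {p | f₁ p ≠ f₂ p ∧ bianchiDenom r₁ r₂ f f₁ f₂ p ≠ 0}

end Surfaces

end Isothermic

end

noncomputable section

namespace Isothermic

/-! ### Vectors in the Clifford algebra -/

section Algebra

variable {n : ℕ}

/-! Write `a = g₁⁻¹`, `b = g₂⁻¹`, `w = r₂ a - r₁ b`. The Riccati equation says `dfᵢ = rᵢ gᵢ dfc gᵢ`,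
and `x ↦ v x v` is a similarity (`sandwich`). Hence `d(gᵢ⁻¹) = gᵢ⁻¹ df gᵢ⁻¹ - rᵢ dfc`, so `fc + rᵢ⁻¹
gᵢ⁻¹` is a Christoffel transform of `fᵢ`, with differential `rᵢ⁻¹ gᵢ⁻¹ df gᵢ⁻¹`. A conformal
immersion determines `dfc`, so both Darboux transforms may use the same `fc`, which then drops out
of `dw`.

The fourth surface is `f + (r₂ - r₁) w⁻¹`. Its difference from `f₁` factors as `r₁ g₁ (b - a) w⁻¹`
(`vec_bianchiStep_sub`). This turns the Riccati equation over `f₁` into the identity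
`sandwich_bianchiStep`, and makes the cross-ratio telescope. Exchanging the indices gives the
equation over `f₂`. Inversion sends the differences from `f` to points of the line through `a` and
`b`, whence concircularity.

For density with `r₁ ≠ r₂`: `w = 0` on an open set would force `df = 0` there, and `f₁ = f₂` on an
open set would force `dfc = 0`, hence `Q = 0` by the identity theorem. With `r₁ = r₂`, Grönwall
uniqueness (`eq_of_darbouxPair_of_eq`) shows that the domain is all of `M`. -/

@[simp] theorem vec_zero : vec (0 : E n) = 0 := map_zero _

@[simp] theorem vec_add (v w : E n) : vec (v + w) = vec v + vec w := map_add _ v w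

@[simp] theorem vec_sub (v w : E n) : vec (v - w) = vec v - vec w := map_sub _ v w

@[simp] theorem vec_neg (v : E n) : vec (-v) = -vec v := map_neg _ v

@[simp] theorem vec_smul (c : ℝ) (v : E n) : vec (c • v) = c • vec v := map_smul _ c v

theorem vec_mul_self_eq_smul (v : E n) : vec v * vec v = (-‖v‖ ^ 2) • (1 : Cl n) := by
  rw [vec_mul_self, Algebra.algebraMap_eq_smul_one]

theorem vec_injective : Function.Injective (vec : E n → Cl n) := by
  intro v w h
  have h0 : vec (v - w) = 0 := by rw [vec_sub, h, sub_self]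
  have h1 : algebraMap ℝ (Cl n) (-‖v - w‖ ^ 2) = algebraMap ℝ (Cl n) 0 := by
    rw [← vec_mul_self, h0, mul_zero, map_zero]
  have h2 := (algebraMap ℝ (Cl n)).injective h1
  rw [neg_eq_zero, sq_eq_zero_iff, norm_eq_zero, sub_eq_zero] at h2
  exact h2

@[simp] theorem vec_eq_zero {v : E n} : vec v = 0 ↔ v = 0 := by
  rw [← vec_zero, vec_injective.eq_iff]

theorem vec_mul_vec_add_swap (v w : E n) :
    vec v * vec w + vec w * vec v = (-2 * ⟪v, w⟫_ℝ) • (1 : Cl n) := by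
  have h := vec_mul_self_eq_smul (v + w)
  rw [vec_add, add_mul, mul_add, mul_add, vec_mul_self_eq_smul, vec_mul_self_eq_smul,
    norm_add_sq_real] at h
  have h' : vec v * vec w + vec w * vec v
      = (-(‖v‖ ^ 2 + 2 * ⟪v, w⟫_ℝ + ‖w‖ ^ 2)) • (1 : Cl n)
        - (-‖v‖ ^ 2) • (1 : Cl n) - (-‖w‖ ^ 2) • (1 : Cl n) := by
    rw [← h]; abel
  rw [h']; module

theorem vec_mul_vec_of_inner_eq_zero {v w : E n} (h : ⟪v, w⟫_ℝ = 0) :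
    vec v * vec w = -(vec w * vec v) := by
  rw [eq_neg_iff_add_eq_zero, vec_mul_vec_add_swap, h, mul_zero, zero_smul]

/-- The inverse `-v / ‖v‖ ^ 2` of a vector in the Clifford algebra. -/
def vecInv (v : E n) : E n := -(‖v‖ ^ 2)⁻¹ • v

/-- The vector `v x v`. -/
def sandwich (v x : E n) : E n := ‖v‖ ^ 2 • x - (2 * ⟪v, x⟫_ℝ) • v

theorem vec_sandwich (v x : E n) : vec (sandwich v x) = vec v * vec x * vec v := by
  have h : vec v * vec x = (-2 * ⟪v, x⟫_ℝ) • (1 : Cl n) - vec x * vec v :=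
    eq_sub_of_add_eq (vec_mul_vec_add_swap v x)
  rw [h, sub_mul, mul_assoc, vec_mul_self_eq_smul, sandwich, vec_sub, vec_smul, vec_smul,
    mul_smul_comm, mul_one, smul_mul_assoc, one_mul]
  module

theorem vec_mul_vec_vecInv {v : E n} (hv : v ≠ 0) : vec v * vec (vecInv v) = 1 := by
  have : ‖v‖ ^ 2 ≠ 0 := by simpa using hv
  rw [vecInv, neg_smul, vec_neg, vec_smul, mul_neg, mul_smul_comm, vec_mul_self_eq_smul, smul_smul,
    ← neg_smul, mul_neg, neg_neg, inv_mul_cancel₀ this, one_smul]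

theorem vec_vecInv_mul_vec {v : E n} (hv : v ≠ 0) : vec (vecInv v) * vec v = 1 := by
  have : ‖v‖ ^ 2 ≠ 0 := by simpa using hv
  rw [vecInv, neg_smul, vec_neg, vec_smul, neg_mul, smul_mul_assoc, vec_mul_self_eq_smul, smul_smul,
    ← neg_smul, mul_neg, neg_neg, inv_mul_cancel₀ this, one_smul]

@[simp] theorem vecInv_zero : vecInv (0 : E n) = 0 := by simp [vecInv]

theorem ringInverse_eq_of_mul_eq_one {R : Type*} [Ring R] {x y : R} (h : x * y = 1)
    (h' : y * x = 1) : Ring.inverse x = y :=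
  Ring.inverse_unit ⟨x, y, h, h'⟩

theorem ringInverse_vec (v : E n) : Ring.inverse (vec v) = vec (vecInv v) := by
  by_cases hv : v = 0
  · simp [hv]
  · exact ringInverse_eq_of_mul_eq_one (vec_mul_vec_vecInv hv) (vec_vecInv_mul_vec hv)

theorem vinv_eq (v : E n) : vinv v = vec (vecInv v) := ringInverse_vec v

theorem vecInv_vecInv (v : E n) : vecInv (vecInv v) = v := by
  by_cases hv : v = 0
  · simp [hv]
  have : ‖v‖ ≠ 0 := by simpa using hv
  simp only [vecInv, norm_smul, norm_neg, norm_inv, norm_pow, norm_norm, smul_smul]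
  convert one_smul ℝ v using 2
  field_simp

@[simp] theorem vecInv_eq_zero {v : E n} : vecInv v = 0 ↔ v = 0 :=
  ⟨fun h => by rw [← vecInv_vecInv v, h, vecInv_zero], fun h => by rw [h, vecInv_zero]⟩

theorem vecInv_injective : Function.Injective (vecInv : E n → E n) :=
  Function.LeftInverse.injective vecInv_vecInv

theorem vecInv_neg (v : E n) : vecInv (-v) = -vecInv v := by simp [vecInv]

theorem sandwich_sub (v x y : E n) : sandwich v (x - y) = sandwich v x - sandwich v y := by
  simp only [sandwich, inner_sub_right]; module

theorem sandwich_smul (v : E n) (c : ℝ) (x : E n) : sandwich v (c • x) = c • sandwich v x := by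
  simp only [sandwich, real_inner_smul_right]; module

theorem smul_sandwich (c : ℝ) (v x : E n) : sandwich (c • v) x = c ^ 2 • sandwich v x := by
  simp only [sandwich, real_inner_smul_left, norm_smul, mul_pow, Real.norm_eq_abs, sq_abs]; module

/-- The map `sandwich v` is `‖v‖ ^ 2` times the reflection in the hyperplane orthogonal to `v`. -/
theorem inner_sandwich_sandwich (v x y : E n) :
    ⟪sandwich v x, sandwich v y⟫_ℝ = ‖v‖ ^ 4 * ⟪x, y⟫_ℝ := by
  simp only [sandwich, inner_sub_left, inner_sub_right, real_inner_smul_left,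
    real_inner_smul_right, real_inner_self_eq_norm_sq, real_inner_comm v x]
  ring

theorem sandwich_vecInv_left (v x : E n) :
    sandwich (vecInv v) x = (‖v‖ ^ 4)⁻¹ • sandwich v x := by
  rw [vecInv, smul_sandwich, neg_sq, ← inv_pow, ← inv_pow, ← pow_mul]

theorem inner_sandwich_sandwich_vecInv {v : E n} (hv : v ≠ 0) (x y : E n) :
    ⟪sandwich v x, sandwich (vecInv v) y⟫_ℝ = ⟪x, y⟫_ℝ := by
  have : ‖v‖ ≠ 0 := by simpa using hv
  rw [sandwich_vecInv_left, real_inner_smul_right, inner_sandwich_sandwich]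
  field_simp

theorem sandwich_vecInv_sandwich {v : E n} (hv : v ≠ 0) (x : E n) :
    sandwich (vecInv v) (sandwich v x) = x := by
  apply vec_injective
  rw [vec_sandwich, vec_sandwich, ← mul_assoc, ← mul_assoc, vec_vecInv_mul_vec hv, one_mul,
    mul_assoc, vec_mul_vec_vecInv hv, mul_one]

theorem sandwich_sandwich_vecInv {v : E n} (hv : v ≠ 0) (x : E n) :
    sandwich v (sandwich (vecInv v) x) = x := by
  have := sandwich_vecInv_sandwich (v := vecInv v) (by simpa using hv) x
  rwa [vecInv_vecInv] at this

theorem sandwich_injective {v : E n} (hv : v ≠ 0) : Function.Injective (sandwich v) :=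
  Function.LeftInverse.injective (sandwich_vecInv_sandwich hv)

/-- This local Lipschitz bound in the outer vector feeds the Grönwall argument for two solutions of
one Riccati equation. -/
theorem norm_sandwich_sub_sandwich_le (u v x : E n) :
    ‖sandwich u x - sandwich v x‖ ≤ 3 * (‖u‖ + ‖v‖) * ‖x‖ * ‖u - v‖ := by
  have e : sandwich u x - sandwich v x = (⟪u - v, u + v⟫_ℝ) • x
      - (2 * ⟪u - v, x⟫_ℝ) • u - (2 * ⟪v, x⟫_ℝ) • (u - v) := by
    have : ⟪u - v, u + v⟫_ℝ = ‖u‖ ^ 2 - ‖v‖ ^ 2 := by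
      rw [inner_sub_left, inner_add_right, inner_add_right, real_inner_self_eq_norm_sq,
        real_inner_self_eq_norm_sq, real_inner_comm]
      ring
    rw [this, inner_sub_left]
    simp only [sandwich]
    module
  rw [e]
  have h1 : ‖(⟪u - v, u + v⟫_ℝ) • x‖ ≤ ‖u - v‖ * (‖u‖ + ‖v‖) * ‖x‖ := by
    rw [norm_smul]
    gcongr
    exact (norm_inner_le_norm _ _).trans (by gcongr; exact norm_add_le _ _)
  have h2 : ‖(2 * ⟪u - v, x⟫_ℝ) • u‖ ≤ 2 * (‖u - v‖ * ‖x‖) * ‖u‖ := by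
    rw [norm_smul, norm_mul, Real.norm_ofNat]
    gcongr
    exact norm_inner_le_norm _ _
  have h3 : ‖(2 * ⟪v, x⟫_ℝ) • (u - v)‖ ≤ 2 * (‖v‖ * ‖x‖) * ‖u - v‖ := by
    rw [norm_smul, norm_mul, Real.norm_ofNat]
    gcongr
    exact norm_inner_le_norm _ _
  have h4 := norm_sub_le ((⟪u - v, u + v⟫_ℝ) • x - (2 * ⟪u - v, x⟫_ℝ) • u)
    ((2 * ⟪v, x⟫_ℝ) • (u - v))
  have h5 := norm_sub_le ((⟪u - v, u + v⟫_ℝ) • x) ((2 * ⟪u - v, x⟫_ℝ) • u)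
  linarith

/-- Two vectors `a, b` that satisfy the linear equations of a Christoffel transform of a
surface with conformal frame `x, y`, with zero right hand side, vanish. -/
theorem eq_zero_of_vec_mul_eq {x y a b : E n} (hx : x ≠ 0) (hxy : ⟪x, y⟫_ℝ = 0)
    (hnorm : ‖x‖ = ‖y‖) (h : vec x * vec b = vec y * vec a) (h₁ : ⟪x, a⟫_ℝ = ⟪y, b⟫_ℝ)
    (h₂ : ⟪x, b⟫_ℝ + ⟪y, a⟫_ℝ = 0) : a = 0 ∧ b = 0 := by
  have hx2 : ‖x‖ ^ 2 ≠ 0 := by simpa using hx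
  have cancel (c : ℝ) (hc : c ≠ 0) (u v : Cl n) (huv : c • u = c • v) : u = v :=
    smul_right_injective _ hc huv
  have one_ne : (1 : Cl n) ≠ 0 := one_ne_zero
  have smul_one_inj {c d : ℝ} (hcd : c • (1 : Cl n) = d • (1 : Cl n)) : c = d :=
    smul_left_injective ℝ one_ne hcd
  have hyx := vec_mul_vec_of_inner_eq_zero hxy
  -- Reversal fixes vectors and reverses products; adding `h` to its reverse compares inner
  -- products.
  have hrev : vec b * vec x = vec a * vec y := by
    have := congrArg CliffordAlgebra.reverse h
    simpa [vec, CliffordAlgebra.reverse.map_mul, CliffordAlgebra.reverse_ι] using this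
  have hxb' : ⟪x, b⟫_ℝ = ⟪y, a⟫_ℝ := by
    have := smul_one_inj (c := -2 * ⟪x, b⟫_ℝ) (d := -2 * ⟪y, a⟫_ℝ) (by
      rw [← vec_mul_vec_add_swap, ← vec_mul_vec_add_swap, h, hrev])
    linarith
  have hxb : ⟪x, b⟫_ℝ = 0 := by linarith
  have hya : ⟪y, a⟫_ℝ = 0 := by linarith
  -- Multiply `h` on the left by `vec y * vec x`, using that `x` and `y` anticommute and have equal
  -- norms.
  have e1 : vec x * vec a = -(vec y * vec b) := by
    apply cancel _ hx2
    have k1 : vec y * (vec x * (vec x * vec b)) = (-‖x‖ ^ 2) • (vec y * vec b) := by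
      rw [← mul_assoc (vec x), vec_mul_self_eq_smul, smul_mul_assoc, one_mul, mul_smul_comm]
    have k2 : vec y * (vec x * (vec y * vec a)) = ‖x‖ ^ 2 • (vec x * vec a) := by
      rw [← mul_assoc (vec x), hyx, neg_mul, mul_neg, mul_assoc, ← mul_assoc (vec y),
        vec_mul_self_eq_smul, ← hnorm, smul_mul_assoc, one_mul, neg_smul, neg_neg]
    rw [← k2, ← h, k1, smul_neg, neg_smul]
  have e1' : vec a * vec x = -(vec b * vec y) := by
    have := congrArg CliffordAlgebra.reverse e1
    simpa [vec, CliffordAlgebra.reverse.map_mul, CliffordAlgebra.reverse_ι] using this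
  have hxa' : ⟪x, a⟫_ℝ = -⟪y, b⟫_ℝ := by
    have := smul_one_inj (c := -2 * ⟪x, a⟫_ℝ) (d := -(-2 * ⟪y, b⟫_ℝ)) (by
      rw [← vec_mul_vec_add_swap, neg_smul, ← vec_mul_vec_add_swap, e1, e1', neg_add])
    linarith
  have hxa : ⟪x, a⟫_ℝ = 0 := by linarith
  have hyb : ⟪y, b⟫_ℝ = 0 := by linarith
  have cxa := vec_mul_vec_of_inner_eq_zero hxa
  have cxb := vec_mul_vec_of_inner_eq_zero hxb
  have inv_x : ∀ u : Cl n, vec x * u = 0 → u = 0 := fun u hu => by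
    rw [← one_mul u, ← vec_vecInv_mul_vec hx, mul_assoc, hu, mul_zero]
  have e2 : vec a * vec x = -(vec y * vec b) := by
    apply cancel _ hx2
    have k0 : ‖x‖ ^ 2 • vec a = -(vec y * (vec x * vec b)) := by
      rw [h, ← mul_assoc, vec_mul_self_eq_smul, ← hnorm, smul_mul_assoc, one_mul, neg_smul, neg_neg]
    rw [← smul_mul_assoc, k0, cxb, mul_neg, neg_neg, mul_assoc, mul_assoc, vec_mul_self_eq_smul,
      mul_smul_comm, mul_smul_comm, mul_one, neg_smul, smul_neg]
  -- By `e1` and `e2`, `x` and `a` commute; by `cxa` they anticommute.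
  have hz : vec x * vec a = 0 := by
    apply cancel 2 two_ne_zero
    rw [smul_zero, two_smul]
    nth_rewrite 1 [e1.trans e2.symm]
    rw [cxa, add_neg_cancel]
  have ha : a = 0 := vec_eq_zero.1 (inv_x _ hz)
  refine ⟨ha, vec_eq_zero.1 (inv_x _ ?_)⟩
  rw [h, ha, vec_zero, mul_zero]

end Algebra

/-! ### Differentials of maps into Euclidean space -/

section Differential

variable {n : ℕ}

theorem contDiffAt_vecInv {v : E n} (hv : v ≠ 0) : ContDiffAt ℝ ∞ (vecInv : E n → E n) v := by
  have h : ContDiffAt ℝ ∞ (fun w : E n => ‖w‖ ^ 2) v := (contDiff_norm_sq ℝ).contDiffAt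
  exact ((h.inv (by simpa using hv)).neg).smul contDiffAt_id

theorem hasFDerivAt_vecInv {v : E n} (hv : v ≠ 0) :
    ∃ D : E n →L[ℝ] E n, HasFDerivAt vecInv D v ∧ ∀ x, D x = -sandwich (vecInv v) x := by
  have hne : ‖v‖ ^ 2 ≠ 0 := by simpa using hv
  have h1 := (hasDerivAt_inv hne).neg.comp_hasFDerivAt v (hasFDerivAt_id (𝕜 := ℝ) v).norm_sq
  refine ⟨_, h1.smul (hasFDerivAt_id (𝕜 := ℝ) v), fun x => ?_⟩
  simp only [vecInv, sandwich]
  have hv' : ‖v‖ ≠ 0 := by simpa using hv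
  simp only [neg_smul, inner_neg_left, norm_neg, norm_smul, real_inner_smul_left, norm_inv,
    norm_pow, norm_norm]
  simp
  match_scalars <;> field_simp

variable {M : Type*} [TopologicalSpace M] [ChartedSpace ℂ M]

/-- Differentiability at a point, as a map between real manifolds. -/
abbrev DiffAt (f : M → E n) (p : M) : Prop := MDifferentiableAt 𝓘(ℝ, ℂ) 𝓘(ℝ, E n) f p

theorem SmoothOn.diffAt {f : M → E n} {U : Set M} (hf : SmoothOn f U) (hU : IsOpen U) {p : M}
    (hp : p ∈ U) : DiffAt f p :=
  (ContMDiffOn.contMDiffAt hf (hU.mem_nhds hp)).mdifferentiableAt (by simp)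

theorem SmoothOn.add {f g : M → E n} {U : Set M} (hf : SmoothOn f U) (hg : SmoothOn g U) :
    SmoothOn (fun p => f p + g p) U := ContMDiffOn.add hf hg

theorem SmoothOn.sub {f g : M → E n} {U : Set M} (hf : SmoothOn f U) (hg : SmoothOn g U) :
    SmoothOn (fun p => f p - g p) U := ContMDiffOn.sub hf hg

theorem SmoothOn.const_smul {f : M → E n} {U : Set M} (c : ℝ) (hf : SmoothOn f U) :
    SmoothOn (fun p => c • f p) U :=
  fun p hp => ContDiff.comp_contMDiffWithinAt (g := fun v : E n => c • v) (contDiff_const_smul c)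
    (hf p hp)

theorem SmoothOn.vecInv {f : M → E n} {U : Set M} (hf : SmoothOn f U) (h0 : ∀ p ∈ U, f p ≠ 0) :
    SmoothOn (fun p => vecInv (f p)) U := fun p hp =>
  ContDiffAt.comp_contMDiffWithinAt (g := Isothermic.vecInv) (f := f)
    (contDiffAt_vecInv (h0 p hp)) (hf p hp)

theorem SmoothOn.mono {f : M → E n} {U V : Set M} (hf : SmoothOn f V) (h : U ⊆ V) :
    SmoothOn f U := ContMDiffOn.mono hf h

theorem diff_add {f g : M → E n} {p : M} (hf : DiffAt f p) (hg : DiffAt g p) (X : ℂ) :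
    diff (fun q => f q + g q) p X = diff f p X + diff g p X := by
  have := (hf.hasMFDerivAt.add hg.hasMFDerivAt).mfderiv
  exact congrArg (fun L : ℂ →L[ℝ] E n => L X) this

theorem diff_sub {f g : M → E n} {p : M} (hf : DiffAt f p) (hg : DiffAt g p) (X : ℂ) :
    diff (fun q => f q - g q) p X = diff f p X - diff g p X := by
  have := (hf.hasMFDerivAt.sub hg.hasMFDerivAt).mfderiv
  exact congrArg (fun L : ℂ →L[ℝ] E n => L X) this

theorem diff_const_smul {f : M → E n} {p : M} (c : ℝ) (hf : DiffAt f p) (X : ℂ) :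
    diff (fun q => c • f q) p X = c • diff f p X := by
  have := (hf.hasMFDerivAt.const_smul c).mfderiv
  exact congrArg (fun L : ℂ →L[ℝ] E n => L X) this

theorem diff_vecInv {f : M → E n} {p : M} (hf : DiffAt f p) (h0 : f p ≠ 0) (X : ℂ) :
    diff (fun q => vecInv (f q)) p X = -sandwich (vecInv (f p)) (diff f p X) := by
  obtain ⟨D, hD, hDx⟩ := hasFDerivAt_vecInv h0
  have := (HasMFDerivAt.comp p hD.hasMFDerivAt hf.hasMFDerivAt).mfderiv
  rw [← hDx]
  exact congrArg (fun L : ℂ →L[ℝ] E n => L X) this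

theorem DiffAt.sub {f g : M → E n} {p : M} (hf : DiffAt f p) (hg : DiffAt g p) :
    DiffAt (fun q => f q - g q) p := MDifferentiableAt.sub hf hg

theorem DiffAt.const_smul {f : M → E n} {p : M} (c : ℝ) (hf : DiffAt f p) :
    DiffAt (fun q => c • f q) p := MDifferentiableAt.const_smul hf c

theorem twoZeroPart_comm (f h : M → E n) (p : M) (X : ℂ) :
    twoZeroPart f h p X = twoZeroPart h f p X := by
  simp only [twoZeroPart, real_inner_comm (diff f p _) (diff h p _)]
  rw [add_comm (⟪diff f p X, diff h p (Complex.I * X)⟫_ℝ)]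

theorem twoZeroPart_of_inner_eq {f h f' h' : M → E n} {p : M} (c : ℝ)
    (H : ∀ X Y, ⟪diff f' p X, diff h' p Y⟫_ℝ = c * ⟪diff f p X, diff h p Y⟫_ℝ) (X : ℂ) :
    twoZeroPart f' h' p X = c * twoZeroPart f h p X := by
  simp only [twoZeroPart, H]
  push_cast
  ring

/-- Reversal in the Clifford algebra carries `df ∧ dh` to `-(dh ∧ df)`. -/
theorem wedge_comm_eq_zero {f h : M → E n} {p : M} {X Y : ℂ} (H : wedge f h p X Y = 0) :
    vec (diff h p X) * vec (diff f p Y) - vec (diff h p Y) * vec (diff f p X) = 0 := by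
  have := congrArg CliffordAlgebra.reverse H
  simp only [wedge, vec, map_sub, CliffordAlgebra.reverse.map_mul, CliffordAlgebra.reverse_ι,
    map_zero] at this
  rw [← neg_eq_zero, neg_sub]
  exact this

theorem map_eq_of_one_of_I (L : ℂ →L[ℝ] E n) (h1 : L 1 = 0) (hI : L Complex.I = 0) (X : ℂ) :
    L X = 0 := by
  have : X = X.re • (1 : ℂ) + X.im • Complex.I := by simp [Complex.re_add_im]
  rw [this, map_add, map_smul, map_smul, h1, hI, smul_zero, smul_zero, add_zero]

/-- The differential of a Christoffel transform of a conformal immersion is unique. -/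
theorem diff_eq_of_isChristoffelOn {Q : QuadraticDifferential M} {f fc fc' : M → E n}
    {U : Set M} (hf : IsConformalImmersionOn f U) (hc : IsChristoffelOn Q f fc U)
    (hc' : IsChristoffelOn Q f fc' U) {p : M} (hp : p ∈ U) (X : ℂ) :
    diff fc p X = diff fc' p X := by
  obtain ⟨hinj, hconf⟩ := hf.2 p hp
  obtain ⟨hw, hQ⟩ := hc.2.2 p hp
  obtain ⟨hw', hQ'⟩ := hc'.2.2 p hp
  have hx : diff f p 1 ≠ 0 := fun h => one_ne_zero (hinj (h.trans (map_zero _).symm))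
  have hre : ∀ {h : M → E n}, twoZeroPart f h p 1 =
      ((((⟪diff f p 1, diff h p 1⟫_ℝ - ⟪diff f p Complex.I, diff h p Complex.I⟫_ℝ) / 4 : ℝ) : ℂ)
      + ((-(⟪diff f p 1, diff h p Complex.I⟫_ℝ + ⟪diff f p Complex.I, diff h p 1⟫_ℝ) / 4 : ℝ) : ℂ)
        * Complex.I) := by
    intro h
    simp only [twoZeroPart, mul_one]
    push_cast
    ring
  have key : ∀ {a b c d : ℝ}, ((a : ℂ) + b * Complex.I = c + d * Complex.I) → a = c ∧ b = d := by
    intro a b c d h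
    have h1 := congrArg Complex.re h
    have h2 := congrArg Complex.im h
    simp at h1 h2
    exact ⟨h1, h2⟩
  have c0 := hconf 1
  rw [hre] at c0
  obtain ⟨c1, c2⟩ := key (c := 0) (d := 0) (c0.trans (by simp))
  obtain ⟨q1, q2⟩ := key (hre.symm.trans (((hQ 1).trans (hQ' 1).symm).trans hre))
  rw [real_inner_self_eq_norm_sq, real_inner_self_eq_norm_sq] at c1
  rw [real_inner_comm] at c2
  have w := hw 1 Complex.I
  have w' := hw' 1 Complex.I
  simp only [wedge] at w w'
  -- The Christoffel conditions are linear in `dfc`, so the difference of two solutions satisfies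
  -- the homogeneous system in the conformal frame given by `1` and `I`.
  obtain ⟨z1, zI⟩ := eq_zero_of_vec_mul_eq (y := diff f p Complex.I)
    (a := diff fc p 1 - diff fc' p 1) (b := diff fc p Complex.I - diff fc' p Complex.I) hx
    (by rw [real_inner_comm]; linarith) (by rw [← sq_eq_sq₀ (norm_nonneg _) (norm_nonneg _)]; linarith)
    (by
      rw [vec_sub, vec_sub, mul_sub, mul_sub, sub_eq_zero.1 w, sub_eq_zero.1 w'])
    (by simp only [inner_sub_right]; linarith) (by simp only [inner_sub_right]; linarith)
  have := map_eq_of_one_of_I (diff fc p - diff fc' p) z1 zI X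
  exact sub_eq_zero.1 this

end Differential

/-! ### Darboux transforms with a prescribed Christoffel transform -/

section Darboux

variable {n : ℕ} {M : Type*} [TopologicalSpace M] [ChartedSpace ℂ M]
  {Q : QuadraticDifferential M} {r : ℝ} {f f' fc : M → E n} {U : Set M}

theorem IsChristoffelOn.mono {V : Set M} (h : IsChristoffelOn Q f fc V) (hUV : U ⊆ V) :
    IsChristoffelOn Q f fc U :=
  ⟨h.1.mono hUV, h.2.1.mono hUV, fun p hp => h.2.2 p (hUV hp)⟩

theorem IsConformalImmersionOn.mono {V : Set M} (h : IsConformalImmersionOn f V) (hUV : U ⊆ V) :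
    IsConformalImmersionOn f U :=
  ⟨h.1.mono hUV, fun p hp => h.2 p (hUV hp)⟩

/-- `f'` is the Darboux transform of `f` with parameter `r` that belongs to the Christoffel
transform `fc`; the Riccati equation is written in terms of vectors. -/
structure DarbouxPair (Q : QuadraticDifferential M) (r : ℝ) (f fc f' : M → E n) (U : Set M) :
    Prop where
  isChristoffelOn : IsChristoffelOn Q f fc U
  smoothOn : SmoothOn f' U
  ne : ∀ p ∈ U, f' p - f p ≠ 0
  diff_eq : ∀ p ∈ U, ∀ X, diff f' p X = r • sandwich (f' p - f p) (diff fc p X)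

/-- Since `dg = df' - df`, the term `-df` cancels from both sides of the Riccati equation. -/
theorem riccati_iff (hU : IsOpen U) (hf : SmoothOn f U) (hf' : SmoothOn f' U) {p : M} (hp : p ∈ U)
    (X : ℂ) : vec (diff (fun q => f' q - f q) p X) =
        r • (vec (f' p - f p) * vec (diff fc p X) * vec (f' p - f p)) - vec (diff f p X) ↔
      diff f' p X = r • sandwich (f' p - f p) (diff fc p X) := by
  rw [diff_sub (hf'.diffAt hU hp) (hf.diffAt hU hp), ← vec_sandwich, ← vec_smul, ← vec_sub,
    vec_injective.eq_iff, sub_left_inj]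

theorem DarbouxPair.isDarbouxOn (hU : IsOpen U) (h : DarbouxPair Q r f fc f' U) :
    IsDarbouxOn Q r f f' U :=
  ⟨fc, h.isChristoffelOn, h.smoothOn, fun p hp => ⟨h.ne p hp, fun X =>
    (riccati_iff hU h.isChristoffelOn.1 h.smoothOn hp X).2 (h.diff_eq p hp X)⟩⟩

theorem IsDarbouxOn.exists_darbouxPair (hU : IsOpen U) (h : IsDarbouxOn Q r f f' U) :
    ∃ fc, DarbouxPair Q r f fc f' U := by
  obtain ⟨fc, hc, hs, H⟩ := h
  exact ⟨fc, hc, hs, fun p hp => (H p hp).1, fun p hp X =>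
    (riccati_iff hU hc.1 hs hp X).1 ((H p hp).2 X)⟩

theorem DarbouxPair.mono {V : Set M} (h : DarbouxPair Q r f fc f' V) (hUV : U ⊆ V) :
    DarbouxPair Q r f fc f' U :=
  ⟨h.1.mono hUV, h.2.mono hUV, fun p hp => h.3 p (hUV hp), fun p hp => h.4 p (hUV hp)⟩

/-- A Darboux transform of a conformal immersion may be taken with respect to any of its
Christoffel transforms. -/
theorem DarbouxPair.change_christoffel {fc' : M → E n} (hf : IsConformalImmersionOn f U)
    (h : DarbouxPair Q r f fc f' U) (hc : IsChristoffelOn Q f fc' U) :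
    DarbouxPair Q r f fc' f' U :=
  ⟨hc, h.2, h.3, fun p hp X => by
    rw [h.4 p hp X, diff_eq_of_isChristoffelOn hf h.1 hc hp]⟩

/-- The Christoffel transform `fc + r⁻¹ g⁻¹` of the Darboux transform `f' = f + g`. -/
def darbouxDual (r : ℝ) (f fc f' : M → E n) (p : M) : E n :=
  fc p + r⁻¹ • vecInv (f' p - f p)

theorem DarbouxPair.smoothOn_darbouxDual (h : DarbouxPair Q r f fc f' U) :
    SmoothOn (darbouxDual r f fc f') U :=
  h.1.2.1.add (((h.2.sub h.1.1).vecInv h.3).const_smul r⁻¹)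

/-- From `d(g⁻¹) = -g⁻¹ dg g⁻¹`: the Riccati equation for `g` becomes affine in `dfc`, with constant
coefficient `-r`. -/
theorem DarbouxPair.diff_vecInv (hU : IsOpen U) (h : DarbouxPair Q r f fc f' U) {p : M}
    (hp : p ∈ U) (X : ℂ) :
    diff (fun q => vecInv (f' q - f q)) p X =
      sandwich (vecInv (f' p - f p)) (diff f p X) - r • diff fc p X := by
  have hf := h.1.1.diffAt hU hp
  have hf' := h.2.diffAt hU hp
  rw [Isothermic.diff_vecInv (f := fun q => f' q - f q) (hf'.sub hf) (h.3 p hp), diff_sub hf' hf,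
    h.4 p hp, sandwich_sub, sandwich_smul, sandwich_vecInv_sandwich (h.3 p hp)]
  abel

theorem DarbouxPair.diff_darbouxDual (hU : IsOpen U) (hr : r ≠ 0)
    (h : DarbouxPair Q r f fc f' U) {p : M} (hp : p ∈ U) (X : ℂ) :
    diff (darbouxDual r f fc f') p X = r⁻¹ • sandwich (vecInv (f' p - f p)) (diff f p X) := by
  have hg : DiffAt (fun q => vecInv (f' q - f q)) p :=
    ((h.2.sub h.1.1).vecInv h.3).diffAt hU hp
  have e : diff (darbouxDual r f fc f') p X =
      diff (fun q => fc q + r⁻¹ • vecInv (f' q - f q)) p X := rfl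
  rw [e, diff_add (h.1.2.1.diffAt hU hp) (hg.const_smul r⁻¹), diff_const_smul r⁻¹ hg,
    h.diff_vecInv hU hp, smul_sub, smul_smul, inv_mul_cancel₀ hr, one_smul]
  abel

/-- The inner factors `g g⁻¹` cancel, so the new wedge is `g (dfc ∧ df) g⁻¹`. The similarities by
`g` and `g⁻¹` have reciprocal factors and the same reflection, so they preserve the pairing that
gives `Q`. -/
theorem DarbouxPair.isChristoffelOn_darbouxDual (hU : IsOpen U) (hr : r ≠ 0)
    (h : DarbouxPair Q r f fc f' U) : IsChristoffelOn Q f' (darbouxDual r f fc f') U := by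
  refine ⟨h.2, h.smoothOn_darbouxDual, fun p hp => ⟨fun X Y => ?_, fun X => ?_⟩⟩
  · have hg := vec_mul_vec_vecInv (h.3 p hp)
    have hw := wedge_comm_eq_zero ((h.1.2.2 p hp).1 X Y)
    have key : ∀ X Y, vec (diff f' p X) * vec (diff (darbouxDual r f fc f') p Y) =
        vec (f' p - f p) * (vec (diff fc p X) * vec (diff f p Y))
          * vec (vecInv (f' p - f p)) := fun X Y => by
      rw [h.4 p hp, h.diff_darbouxDual hU hr hp, vec_smul, vec_smul, vec_sandwich, vec_sandwich,
        smul_mul_smul_comm, mul_inv_cancel₀ hr, one_smul]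
      simp only [mul_assoc]
      rw [← mul_assoc (vec (f' p - f p)) (vec (vecInv (f' p - f p))), hg, one_mul]
    rw [wedge, key, key, ← sub_mul, ← mul_sub, hw, mul_zero, zero_mul]
  · rw [← (h.1.2.2 p hp).2 X, twoZeroPart_comm f fc, ← one_mul (twoZeroPart fc f p X)]
    refine (twoZeroPart_of_inner_eq 1 (fun X Y => ?_) X).trans (by rw [Complex.ofReal_one])
    rw [h.4 p hp, h.diff_darbouxDual hU hr hp, real_inner_smul_left, real_inner_smul_right,
      inner_sandwich_sandwich_vecInv (h.3 p hp)]
    field_simp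

/-- A map whose differential is pointwise a similarity applied to that of a conformal immersion
is a conformal immersion. -/
theorem IsConformalImmersionOn.of_sandwich {h : M → E n} (hh : SmoothOn h U)
    (hf : IsConformalImmersionOn f U) (c : ℝ) (hc : c ≠ 0) (v : M → E n) (hv : ∀ p ∈ U, v p ≠ 0)
    (H : ∀ p ∈ U, ∀ X, diff h p X = c • sandwich (v p) (diff f p X)) :
    IsConformalImmersionOn h U := by
  refine ⟨hh, fun p hp => ⟨fun X Y hXY => ?_, fun X => ?_⟩⟩
  · rw [H p hp, H p hp] at hXY
    exact (hf.2 p hp).1 (sandwich_injective (hv p hp) (smul_right_injective _ hc hXY))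
  · rw [twoZeroPart_of_inner_eq (f := f) (h := f) (c * c * ‖v p‖ ^ 4) (fun X Y => ?_) X,
      (hf.2 p hp).2 X, mul_zero]
    rw [H p hp, H p hp, real_inner_smul_left, real_inner_smul_right, inner_sandwich_sandwich]
    ring

theorem DarbouxPair.isConformalImmersionOn_darbouxDual (hU : IsOpen U) (hr : r ≠ 0)
    (h : DarbouxPair Q r f fc f' U) (hf : IsConformalImmersionOn f U) :
    IsConformalImmersionOn (darbouxDual r f fc f') U :=
  hf.of_sandwich h.smoothOn_darbouxDual r⁻¹ (inv_ne_zero hr) (fun p => vecInv (f' p - f p))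
    (fun p hp => by simpa [sub_eq_zero] using h.3 p hp) fun p hp X => h.diff_darbouxDual hU hr hp X

theorem DarbouxPair.isConformalImmersionOn (hr : r ≠ 0)
    (h : DarbouxPair Q r f fc f' U) (hfc : IsConformalImmersionOn fc U) :
    IsConformalImmersionOn f' U :=
  hfc.of_sandwich h.2 r hr (fun p => f' p - f p) h.3 h.4

end Darboux

/-! ### The fourth surface -/

section Bianchi

variable {n : ℕ}

/-- The vector `r₂ g₁⁻¹ - r₁ g₂⁻¹`. -/
def bianchiVec (r₁ r₂ : ℝ) (g₁ g₂ : E n) : E n := r₂ • vecInv g₁ - r₁ • vecInv g₂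

theorem bianchiVec_swap (r₁ r₂ : ℝ) (g₁ g₂ : E n) :
    bianchiVec r₂ r₁ g₂ g₁ = -bianchiVec r₁ r₂ g₁ g₂ := by
  rw [bianchiVec, bianchiVec, neg_sub]

/-- The vector from the first to the fourth point. -/
def bianchiStep (r₁ r₂ : ℝ) (g₁ g₂ : E n) : E n :=
  (r₂ - r₁) • vecInv (bianchiVec r₁ r₂ g₁ g₂)

theorem bianchiStep_swap (r₁ r₂ : ℝ) (g₁ g₂ : E n) :
    bianchiStep r₂ r₁ g₂ g₁ = bianchiStep r₁ r₂ g₁ g₂ := by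
  rw [bianchiStep, bianchiStep, bianchiVec_swap, vecInv_neg, smul_neg, ← neg_smul, neg_sub]

variable {r₁ r₂ : ℝ} {g₁ g₂ : E n}

/-- Expand `(r₂ - r₁) - g₁ w = r₁ g₁ (g₂⁻¹ - g₁⁻¹)`, where `w` is the `bianchiVec`, and multiply by
`w⁻¹` on the right. -/
theorem vec_bianchiStep_sub (h₁ : g₁ ≠ 0) (hw : bianchiVec r₁ r₂ g₁ g₂ ≠ 0) :
    vec (bianchiStep r₁ r₂ g₁ g₂ - g₁) =
      r₁ • (vec g₁ * vec (vecInv g₂ - vecInv g₁) * vec (vecInv (bianchiVec r₁ r₂ g₁ g₂))) := by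
  have hwi := vec_mul_vec_vecInv hw
  have key : r₁ • (vec g₁ * vec (vecInv g₂ - vecInv g₁)) =
      (r₂ - r₁) • (1 : Cl n) - vec g₁ * vec (bianchiVec r₁ r₂ g₁ g₂) := by
    rw [bianchiVec, vec_sub, vec_sub, vec_smul, vec_smul, mul_sub, mul_sub, mul_smul_comm,
      mul_smul_comm, vec_mul_vec_vecInv h₁]
    module
  rw [← smul_mul_assoc, key, sub_mul, mul_assoc, hwi, smul_mul_assoc, one_mul, mul_one, vec_sub,
    bianchiStep, vec_smul]

/-- A vector is its own reverse, so the factors may be read backwards; having both orders lets `g₁`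
cancel from either side. -/
theorem vec_bianchiStep_sub' (h₁ : g₁ ≠ 0) (hw : bianchiVec r₁ r₂ g₁ g₂ ≠ 0) :
    vec (bianchiStep r₁ r₂ g₁ g₂ - g₁) =
      r₁ • (vec (vecInv (bianchiVec r₁ r₂ g₁ g₂)) * vec (vecInv g₂ - vecInv g₁) * vec g₁) := by
  have := congrArg CliffordAlgebra.reverse (vec_bianchiStep_sub h₁ hw)
  simpa only [vec, map_smul, CliffordAlgebra.reverse.map_mul, CliffordAlgebra.reverse_ι,
    mul_assoc] using this

theorem bianchiStep_sub_ne_zero (hr₁ : r₁ ≠ 0) (h₁ : g₁ ≠ 0) (hne : g₁ ≠ g₂)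
    (hw : bianchiVec r₁ r₂ g₁ g₂ ≠ 0) : bianchiStep r₁ r₂ g₁ g₂ - g₁ ≠ 0 := by
  intro h
  have e := vec_bianchiStep_sub h₁ hw
  rw [h, vec_zero, eq_comm, smul_eq_zero_iff_right hr₁] at e
  have e2 : vec (vecInv g₂ - vecInv g₁) = vec (vecInv g₁) * (vec g₁ * vec (vecInv g₂ - vecInv g₁)
      * vec (vecInv (bianchiVec r₁ r₂ g₁ g₂))) * vec (bianchiVec r₁ r₂ g₁ g₂) := by
    rw [mul_assoc, mul_assoc (_ * _), vec_vecInv_mul_vec hw, mul_one, ← mul_assoc,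
      vec_vecInv_mul_vec h₁, one_mul]
  rw [e, mul_zero, zero_mul, vec_eq_zero, sub_eq_zero] at e2
  exact hne (vecInv_injective e2).symm

/-- With `x` in the role of `df`, the left side is the differential of the fourth surface and the
right side is the Riccati expression over `f₁`. -/
theorem sandwich_bianchiStep (hr₁ : r₁ ≠ 0) (h₁ : g₁ ≠ 0)
    (hw : bianchiVec r₁ r₂ g₁ g₂ ≠ 0) (x : E n) :
    x - (r₂ - r₁) • sandwich (vecInv (bianchiVec r₁ r₂ g₁ g₂))
        (r₂ • sandwich (vecInv g₁) x - r₁ • sandwich (vecInv g₂) x) =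
      r₂ • sandwich (bianchiStep r₁ r₂ g₁ g₂ - g₁) (r₁⁻¹ • sandwich (vecInv g₁) x) := by
  have e : sandwich (bianchiStep r₁ r₂ g₁ g₂ - g₁) (sandwich (vecInv g₁) x) =
      r₁ ^ 2 • sandwich (vecInv (bianchiVec r₁ r₂ g₁ g₂)) (sandwich (vecInv g₂ - vecInv g₁) x) := by
    apply vec_injective
    rw [vec_sandwich, vec_sandwich, vec_smul, vec_sandwich, vec_sandwich]
    -- The two outer factors are expanded in opposite orders, so that `g₁` meets `g₁⁻¹` on both
    -- sides of `x`.
    nth_rewrite 1 [vec_bianchiStep_sub' h₁ hw]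
    rw [vec_bianchiStep_sub h₁ hw]
    simp only [smul_mul_assoc, mul_smul_comm, smul_smul, mul_assoc, sq]
    rw [← mul_assoc (vec g₁), vec_mul_vec_vecInv h₁, one_mul,
      ← mul_assoc (vec (vecInv g₁)) (vec g₁), vec_vecInv_mul_vec h₁, one_mul]
  -- After multiplication by `w` on both sides, each side equals `r₁ r₂ (b - a) x (b - a)`, with `a
  -- = g₁⁻¹` and `b = g₂⁻¹`.
  apply sandwich_injective hw
  rw [sandwich_smul _ r₁⁻¹, e, sandwich_sub, sandwich_smul, sandwich_smul, sandwich_smul,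
    sandwich_smul, sandwich_sandwich_vecInv hw, sandwich_sandwich_vecInv hw]
  apply vec_injective
  simp only [vec_sub, vec_smul, vec_sandwich, bianchiVec, mul_sub, sub_mul, smul_mul_assoc,
    mul_smul_comm, smul_sub, smul_smul]
  match_scalars <;> field_simp <;> ring

end Bianchi

/-! ### The fourth surface as a map, and its Riccati equation. -/

section BianchiMaps

variable {n : ℕ} {M : Type*}

/-- The fourth surface of a Bianchi quadrilateral. -/
def bianchiMap (r₁ r₂ : ℝ) (f f₁ f₂ : M → E n) (p : M) : E n :=
  f p + bianchiStep r₁ r₂ (f₁ p - f p) (f₂ p - f p)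

theorem bianchiMap_swap (r₁ r₂ : ℝ) (f f₁ f₂ : M → E n) :
    bianchiMap r₂ r₁ f f₂ f₁ = bianchiMap r₁ r₂ f f₁ f₂ := by
  funext p
  rw [bianchiMap, bianchiStep_swap, bianchiMap]

theorem bianchiMap_sub (r₁ r₂ : ℝ) (f f₁ f₂ : M → E n) (p : M) :
    bianchiMap r₁ r₂ f f₁ f₂ p - f₁ p =
      bianchiStep r₁ r₂ (f₁ p - f p) (f₂ p - f p) - (f₁ p - f p) := by
  rw [bianchiMap]; abel

variable [TopologicalSpace M] [ChartedSpace ℂ M]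
  {Q : QuadraticDifferential M} {r₁ r₂ : ℝ} {f fc f₁ f₂ : M → E n} {U : Set M}

theorem smoothOn_bianchiVec (h₁ : DarbouxPair Q r₁ f fc f₁ U) (h₂ : DarbouxPair Q r₂ f fc f₂ U) :
    SmoothOn (fun p => bianchiVec r₁ r₂ (f₁ p - f p) (f₂ p - f p)) U :=
  (((h₁.2.sub h₁.1.1).vecInv h₁.3).const_smul r₂).sub
    (((h₂.2.sub h₂.1.1).vecInv h₂.3).const_smul r₁)

/-- The multiples `r₂ r₁` and `r₁ r₂` of `dfc` cancel; this is where a common `fc` is needed. -/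
theorem diff_bianchiVec (hU : IsOpen U) (h₁ : DarbouxPair Q r₁ f fc f₁ U)
    (h₂ : DarbouxPair Q r₂ f fc f₂ U) {p : M} (hp : p ∈ U) (X : ℂ) :
    diff (fun p => bianchiVec r₁ r₂ (f₁ p - f p) (f₂ p - f p)) p X =
      r₂ • sandwich (vecInv (f₁ p - f p)) (diff f p X) -
        r₁ • sandwich (vecInv (f₂ p - f p)) (diff f p X) := by
  have d₁ : DiffAt (fun q => vecInv (f₁ q - f q)) p :=
    ((h₁.2.sub h₁.1.1).vecInv h₁.3).diffAt hU hp
  have d₂ : DiffAt (fun q => vecInv (f₂ q - f q)) p :=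
    ((h₂.2.sub h₂.1.1).vecInv h₂.3).diffAt hU hp
  simp only [bianchiVec]
  rw [diff_sub (d₁.const_smul r₂) (d₂.const_smul r₁), diff_const_smul r₂ d₁, diff_const_smul r₁ d₂,
    h₁.diff_vecInv hU hp, h₂.diff_vecInv hU hp]
  module

/-- Permutability: the fourth surface is a Darboux transform of the second one. -/
theorem darbouxPair_bianchiMap (hU : IsOpen U) (hr₁ : r₁ ≠ 0) (h₁ : DarbouxPair Q r₁ f fc f₁ U)
    (h₂ : DarbouxPair Q r₂ f fc f₂ U) (hne : ∀ p ∈ U, f₁ p ≠ f₂ p)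
    (hw : ∀ p ∈ U, bianchiVec r₁ r₂ (f₁ p - f p) (f₂ p - f p) ≠ 0) :
    DarbouxPair Q r₂ f₁ (darbouxDual r₁ f fc f₁) (bianchiMap r₁ r₂ f f₁ f₂) U := by
  have hs := (smoothOn_bianchiVec h₁ h₂).vecInv hw
  refine ⟨h₁.isChristoffelOn_darbouxDual hU hr₁, h₁.1.1.add (hs.const_smul (r₂ - r₁)),
    fun p hp => ?_, fun p hp X => ?_⟩
  · rw [bianchiMap_sub]
    exact bianchiStep_sub_ne_zero hr₁ (h₁.3 p hp) (fun h => hne p hp (sub_left_injective h))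
      (hw p hp)
  · have e : diff (bianchiMap r₁ r₂ f f₁ f₂) p X = diff (fun q => f q + (r₂ - r₁) •
        vecInv (bianchiVec r₁ r₂ (f₁ q - f q) (f₂ q - f q))) p X := rfl
    have hd := hs.diffAt hU hp
    rw [bianchiMap_sub, h₁.diff_darbouxDual hU hr₁ hp, e,
      ← sandwich_bianchiStep hr₁ (h₁.3 p hp) (hw p hp),
      diff_add (h₁.1.1.diffAt hU hp) (hd.const_smul _), diff_const_smul _ hd,
      diff_vecInv ((smoothOn_bianchiVec h₁ h₂).diffAt hU hp) (hw p hp),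
      diff_bianchiVec hU h₁ h₂ hp, smul_neg, ← sub_eq_add_neg]

end BianchiMaps

/-! ### Concircularity and cross-ratio -/

section Concircular

variable {n : ℕ} {r₁ r₂ : ℝ} {g₁ g₂ : E n}

/-- Once both differences from the fourth point are factored, every vector in the product meets its
inverse and only `r₁⁻¹ r₂` remains. -/
theorem crossRatio_bianchiStep (x : E n) (hr₁ : r₁ ≠ 0) (h₁ : g₁ ≠ 0) (h₂ : g₂ ≠ 0) (hne : g₁ ≠ g₂)
    (hw : bianchiVec r₁ r₂ g₁ g₂ ≠ 0) :
    crossRatio x (x + g₁) (x + bianchiStep r₁ r₂ g₁ g₂) (x + g₂) =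
      algebraMap ℝ (Cl n) (r₂ / r₁) := by
  have hd : vecInv g₂ - vecInv g₁ ≠ 0 := fun h => hne (vecInv_injective (sub_eq_zero.1 h)).symm
  have hinv : vec (vecInv (bianchiStep r₁ r₂ g₁ g₂ - g₁)) = r₁⁻¹ • (vec (vecInv g₁) *
      vec (vecInv (vecInv g₂ - vecInv g₁)) * vec (bianchiVec r₁ r₂ g₁ g₂)) := by
    rw [← ringInverse_vec]
    apply ringInverse_eq_of_mul_eq_one
    · rw [vec_bianchiStep_sub' h₁ hw, smul_mul_smul_comm, mul_inv_cancel₀ hr₁, one_smul]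
      simp only [mul_assoc]
      rw [← mul_assoc (vec g₁), vec_mul_vec_vecInv h₁, one_mul,
        ← mul_assoc (vec (vecInv g₂ - vecInv g₁)), vec_mul_vec_vecInv hd, one_mul,
        vec_vecInv_mul_vec hw]
    · rw [vec_bianchiStep_sub' h₁ hw, smul_mul_smul_comm, inv_mul_cancel₀ hr₁, one_smul]
      simp only [mul_assoc]
      rw [← mul_assoc (vec (bianchiVec _ _ _ _)), vec_mul_vec_vecInv hw, one_mul,
        ← mul_assoc (vec (vecInv (_ - _))), vec_vecInv_mul_vec hd, one_mul,
        vec_vecInv_mul_vec h₁]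
  have hw' : bianchiVec r₂ r₁ g₂ g₁ ≠ 0 := by rwa [bianchiVec_swap, neg_ne_zero]
  -- Exchanging the indices negates both `bianchiVec` and the difference of inverses, so the signs
  -- cancel.
  have h3 : vec (bianchiStep r₁ r₂ g₁ g₂ - g₂) = r₂ • (vec (vecInv (bianchiVec r₁ r₂ g₁ g₂)) *
      vec (vecInv g₂ - vecInv g₁) * vec g₂) := by
    rw [← bianchiStep_swap, vec_bianchiStep_sub' h₂ hw', bianchiVec_swap, vecInv_neg, vec_neg,
      ← neg_sub (vecInv g₂), vec_neg, neg_mul_neg]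
  have e1 : x + g₁ - x = g₁ := add_sub_cancel_left _ _
  have e2 : x + g₂ - x = g₂ := add_sub_cancel_left _ _
  rw [crossRatio, vinv_eq, vinv_eq, e1, e2, add_sub_add_left_eq_sub, add_sub_add_left_eq_sub, hinv,
    h3, mul_smul_comm (r₁⁻¹), smul_mul_smul_comm, smul_mul_assoc, Algebra.algebraMap_eq_smul_one]
  simp only [mul_assoc]
  rw [vec_mul_vec_vecInv h₂, mul_one, ← mul_assoc (vec (bianchiVec _ _ _ _)),
    vec_mul_vec_vecInv hw, one_mul, vec_vecInv_mul_vec hd, mul_one, vec_mul_vec_vecInv h₁,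
    div_eq_inv_mul]

/-- A vector lies on the sphere through `0` with centre `c` if its inverse lies on a
hyperplane. -/
theorem dist_eq_norm_of_inner_vecInv {c g : E n} (hg : g ≠ 0) (h : ⟪c, vecInv g⟫_ℝ = -1 / 2) :
    dist g c = ‖c‖ := by
  have hg2 : ‖g‖ ^ 2 ≠ 0 := by simpa using hg
  have h2 : ‖g‖ ^ 2 = 2 * ⟪g, c⟫_ℝ := by
    rw [vecInv, real_inner_smul_right, real_inner_comm] at h
    field_simp at h
    linarith
  rw [dist_eq_norm, ← sq_eq_sq₀ (norm_nonneg _) (norm_nonneg _), norm_sub_sq_real]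
  linarith

/-- The inverses of the nonzero differences from `x` lie on one line, since `(r₂ a - r₁ b) / (r₂ -
r₁)` is an affine combination of `a` and `b`. Inversion takes this line to a circle through the
origin, or to a line if it passes through the origin. -/
theorem concircular_bianchiStep (x : E n) (h₁ : g₁ ≠ 0) (h₂ : g₂ ≠ 0) (hne : g₁ ≠ g₂)
    (hw : bianchiVec r₁ r₂ g₁ g₂ ≠ 0) :
    Concircular {x, x + g₁, x + bianchiStep r₁ r₂ g₁ g₂, x + g₂} := by
  set a := vecInv g₁ with ha
  set b := vecInv g₂ with hb
  have hab : b - a ≠ 0 := fun h => hne (vecInv_injective (sub_eq_zero.1 h)).symm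
  set s := ⟪a, b - a⟫_ℝ / ‖b - a‖ ^ 2 with hs
  -- The foot of the perpendicular from the origin to the line through `a` and `b`.
  set m := a - s • (b - a) with hm
  have hd2 : ‖b - a‖ ^ 2 ≠ 0 := by simpa using hab
  have hg₁ : g₁ = vecInv a := (vecInv_vecInv g₁).symm
  have hg₂ : g₂ = vecInv b := (vecInv_vecInv g₂).symm
  have hstep : bianchiStep r₁ r₂ g₁ g₂ = (r₂ - r₁) • vecInv (r₂ • a - r₁ • b) := rfl
  have hw' : r₂ • a - r₁ • b ≠ 0 := hw
  by_cases h0 : m = 0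
  · right
    have ea : a = s • (b - a) := sub_eq_zero.1 h0
    have eb : b = (1 + s) • (b - a) := by rw [add_smul, one_smul, ← ea]; abel
    rw [collinear_iff_of_mem (p₀ := x) (by simp)]
    refine ⟨b - a, ?_⟩
    have inv_mem : ∀ t : ℝ, ∀ v : E n, v = t • (b - a) → ∃ u : ℝ, vecInv v = u • (b - a) :=
      fun t v hv => ⟨-(‖v‖ ^ 2)⁻¹ * t, by rw [vecInv, mul_smul, ← hv]⟩
    obtain ⟨u₁, hu₁⟩ := inv_mem _ _ ea
    obtain ⟨u₂, hu₂⟩ := inv_mem _ _ eb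
    obtain ⟨u₃, hu₃⟩ := inv_mem (r₂ * s - r₁ * (1 + s)) (r₂ • a - r₁ • b) (by
      rw [sub_smul, mul_smul, mul_smul, ← ea, ← eb])
    simp only [Set.mem_insert_iff, Set.mem_singleton_iff, vadd_eq_add]
    rintro p (rfl | rfl | rfl | rfl)
    · exact ⟨0, by simp⟩
    · exact ⟨u₁, by rw [hg₁, hu₁, add_comm]⟩
    · exact ⟨(r₂ - r₁) * u₃, by rw [hstep, hu₃, mul_smul, add_comm]⟩
    · exact ⟨u₂, by rw [hg₂, hu₂, add_comm]⟩
  · left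
    have hm2 : ‖m‖ ^ 2 ≠ 0 := by simpa using h0
    have hmd : ⟪m, b - a⟫_ℝ = 0 := by
      rw [hm, inner_sub_left, real_inner_smul_left, real_inner_self_eq_norm_sq, hs]
      field_simp
      ring
    have hma : ⟪m, a⟫_ℝ = ‖m‖ ^ 2 := by
      have : a = m + s • (b - a) := by rw [hm]; abel
      conv_lhs => rw [this]
      rw [inner_add_right, real_inner_smul_right, hmd, mul_zero, add_zero,
        real_inner_self_eq_norm_sq]
    have hmb : ⟪m, b⟫_ℝ = ‖m‖ ^ 2 := by
      rw [← hma, ← sub_eq_zero, ← inner_sub_right, hmd]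
    -- Scaled so that `⟪c, ·⟫ = -1 / 2` on the line through `a` and `b`; the inverses then lie on
    -- the sphere through the origin with centre `c`.
    set c : E n := (-1 / 2 * (‖m‖ ^ 2)⁻¹) • m with hc
    have hca : ⟪c, a⟫_ℝ = -1 / 2 := by
      rw [hc, real_inner_smul_left, hma, mul_assoc, inv_mul_cancel₀ hm2, mul_one]
    have hcb : ⟪c, b⟫_ℝ = -1 / 2 := by
      rw [hc, real_inner_smul_left, hmb, mul_assoc, inv_mul_cancel₀ hm2, mul_one]
    refine ⟨⟨x + c, ‖c‖, ?_⟩, ?_⟩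
    · simp only [Set.mem_insert_iff, Set.mem_singleton_iff]
      rintro p (rfl | rfl | rfl | rfl)
      · simp [dist_eq_norm]
      · rw [dist_add_left]
        exact dist_eq_norm_of_inner_vecInv h₁ hca
      · rw [dist_add_left]
        -- For equal parameters the fourth point is `x` itself.
        by_cases hr : r₂ - r₁ = 0
        · simp [hstep, hr]
        refine dist_eq_norm_of_inner_vecInv ?_ ?_
        · rw [hstep]
          exact smul_ne_zero hr (by simpa using hw')
        · have : vecInv (bianchiStep r₁ r₂ g₁ g₂) = (r₂ - r₁)⁻¹ • (r₂ • a - r₁ • b) := by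
            rw [hstep, vecInv, norm_smul, mul_pow, Real.norm_eq_abs, sq_abs]
            conv_rhs => rw [← vecInv_vecInv (r₂ • a - r₁ • b)]
            rw [vecInv.eq_1 (vecInv _), smul_smul, smul_smul]
            congr 1
            have : ‖vecInv (r₂ • a - r₁ • b)‖ ≠ 0 := by simpa using hw'
            field_simp
          rw [this, real_inner_smul_right, inner_sub_right, real_inner_smul_right,
            real_inner_smul_right, hca, hcb]
          field_simp
          ring
      · rw [dist_add_left]
        exact dist_eq_norm_of_inner_vecInv h₂ hcb
    -- Being concyclic also requires coplanarity: all differences from `x` lie in the span of `g₁`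
    -- and `g₂`.
    · have hsub : vectorSpan ℝ ({x, x + g₁, x + bianchiStep r₁ r₂ g₁ g₂, x + g₂} : Set (E n)) ≤
          Submodule.span ℝ {g₁, g₂} := by
        have m₁ : g₁ ∈ Submodule.span ℝ {g₁, g₂} := Submodule.subset_span (by simp)
        have m₂ : g₂ ∈ Submodule.span ℝ {g₁, g₂} := Submodule.subset_span (by simp)
        rw [vectorSpan_eq_span_vsub_set_right ℝ (p := x) (by simp), Submodule.span_le]
        rintro _ ⟨p, hp, rfl⟩
        simp only [Set.mem_insert_iff, Set.mem_singleton_iff] at hp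
        rcases hp with rfl | rfl | rfl | rfl
        · simp
        · simpa using m₁
        · simp only [vsub_eq_sub, add_sub_cancel_left]
          exact Submodule.smul_mem _ _ (Submodule.smul_mem _ _ (Submodule.sub_mem _
            (Submodule.smul_mem _ _ (Submodule.smul_mem _ _ m₁))
            (Submodule.smul_mem _ _ (Submodule.smul_mem _ _ m₂))))
        · simpa using m₂
      exact (Submodule.rank_mono hsub).trans
        ((rank_span_le _).trans ((Cardinal.mk_insert_le).trans (by
          rw [Cardinal.mk_singleton]; norm_num)))

end Concircular

/-! ### Unique continuation -/

section Unique

variable {n : ℕ} {M : Type*} [TopologicalSpace M] [ChartedSpace ℂ M]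

/-- A Riemann surface is a smooth real manifold. -/
theorem isManifold_real [IsManifold 𝓘(ℂ, ℂ) ω M] : IsManifold 𝓘(ℝ, ℂ) ∞ M := by
  refine isManifold_of_contDiffOn _ _ _ fun e e' he he' => ?_
  have h := (contDiffGroupoid ω 𝓘(ℂ, ℂ)).compatible he he'
  rw [contDiffGroupoid, mem_groupoid_of_pregroupoid] at h
  have h1 : ContDiffOn ℂ ω (𝓘(ℂ, ℂ) ∘ e.symm ≫ₕ e' ∘ 𝓘(ℂ, ℂ).symm)
    (𝓘(ℂ, ℂ).symm ⁻¹' (e.symm ≫ₕ e').source ∩ Set.range 𝓘(ℂ, ℂ)) := h.1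
  exact (h1.restrict_scalars ℝ).of_le le_top

/-- The tangent space is a complex line, so one nonzero vector determines the bilinear form. -/
theorem QuadraticDifferential.form_eq_zero_of_apply_eq_zero (Q : QuadraticDifferential M) {p : M}
    {X : ℂ} (hX : X ≠ 0) (h : Q.form p X X = 0) : Q.form p = 0 := by
  have e : ∀ Y : ℂ, Y = (Y / X) • X := fun Y => by rw [smul_eq_mul, div_mul_cancel₀ _ hX]
  have key : ∀ Y Z : ℂ, Q.form p Y Z = 0 := fun Y Z => by
    let B : ℂ →L[ℂ] ℂ →L[ℂ] ℂ := Q.form p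
    have hB : B X X = 0 := h
    change B Y Z = 0
    rw [e Y, e Z, map_smul, map_smul, smul_apply, hB, smul_zero, smul_zero]
  ext
  exact key _ _

/-- The identity theorem for holomorphic quadratic differentials. -/
theorem QuadraticDifferential.form_eq_zero_of_eventually [ConnectedSpace M]
    [IsManifold 𝓘(ℂ, ℂ) ω M] (Q : QuadraticDifferential M) {p₀ : M}
    (h0 : ∀ᶠ p in nhds p₀, Q.form p = 0) (p : M) : Q.form p = 0 := by
  have : IsManifold 𝓘(ℂ, ℂ) 1 M := IsManifold.of_le (n := ω) le_top
  -- The interior of the zero set is shown to be clopen: near a limit point, the one-variable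
  -- identity theorem applies on a chart ball.
  set S : Set M := {p | ∀ᶠ q in nhds p, Q.form q = 0} with hS
  have hopen : IsOpen S := isOpen_iff_mem_nhds.2 fun p hp => eventually_eventually_nhds.2 hp
  have hclosed : IsClosed S := by
    refine isClosed_of_closure_subset fun p hp => ?_
    set φ := chartAt ℂ p with hφ
    set q : ℂ → ℂ := fun z => Q.form (φ.symm z) (mfderiv 𝓘(ℂ, ℂ) 𝓘(ℂ, ℂ) φ.symm z (1 : ℂ))
      (mfderiv 𝓘(ℂ, ℂ) 𝓘(ℂ, ℂ) φ.symm z (1 : ℂ)) with hq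
    have hps : p ∈ φ.source := mem_chart_source ℂ p
    obtain ⟨ρ, hρ, hball⟩ := Metric.isOpen_iff.1 φ.open_target (φ p) (φ.map_source hps)
    have hqan : AnalyticOnNhd ℂ q (Metric.ball (φ p) ρ) :=
      ((Q.holomorphic p).mono hball).analyticOnNhd Metric.isOpen_ball
    have hnhds : φ.source ∩ φ ⁻¹' Metric.ball (φ p) ρ ∈ nhds p :=
      (φ.isOpen_inter_preimage Metric.isOpen_ball).mem_nhds ⟨hps, Metric.mem_ball_self hρ⟩
    obtain ⟨p₁, ⟨hp₁s, hp₁b⟩, hp₁S⟩ := mem_closure_iff_nhds.1 hp _ hnhds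
    have hev : q =ᶠ[nhds (φ p₁)] 0 := by
      have ht : Filter.Tendsto φ.symm (nhds (φ p₁)) (nhds p₁) := φ.tendsto_symm hp₁s
      filter_upwards [ht.eventually hp₁S] with z hz
      have hz' : Q.form (φ.symm z) = 0 := hz
      simp only [hq, hz']
      rfl
    have hzero := hqan.eqOn_zero_of_preconnected_of_eventuallyEq_zero
      (convex_ball _ _).isPreconnected hp₁b hev
    filter_upwards [hnhds] with x hx
    have hmd := (mdifferentiable_chart (I := 𝓘(ℂ, ℂ)) p).symm
    have hinj := hmd.mfderiv_injective (x := φ x) (φ.map_source hx.1)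
    have hx0 := hzero hx.2
    simp only [hq, Pi.zero_apply] at hx0
    rw [← φ.left_inv hx.1]
    refine Q.form_eq_zero_of_apply_eq_zero ?_ hx0
    intro h
    exact one_ne_zero (α := ℂ) (hinj (h.trans (map_zero _).symm))
  have := IsClopen.eq_univ ⟨hclosed, hopen⟩ ⟨p₀, h0⟩
  have hp : p ∈ S := this ▸ Set.mem_univ p
  exact hp.self_of_nhds

/-- A solution of a linear differential inequality on a ball vanishes if it does so at the
centre. -/
theorem eq_zero_on_ball_of_norm_fderiv_le {E₁ E₂ : Type*} [NormedAddCommGroup E₁] [NormedSpace ℝ E₁]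
    [NormedAddCommGroup E₂] [NormedSpace ℝ E₂] {H : E₁ → E₂} {L : E₁ → E₁ →L[ℝ] E₂} {C ρ : ℝ}
    {z₀ : E₁} (hH : ∀ z ∈ Metric.ball z₀ ρ, HasFDerivAt H (L z) z)
    (hC : ∀ z ∈ Metric.ball z₀ ρ, ‖L z‖ ≤ C * ‖H z‖) (h0 : H z₀ = 0) {z : E₁}
    (hz : z ∈ Metric.ball z₀ ρ) : H z = 0 := by
  have hpos : 0 < ρ := dist_nonneg.trans_lt hz
  -- Restrict to the segment from the centre to `z`, where Grönwall's inequality applies.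
  have hpath : ∀ t ∈ Set.Icc (0 : ℝ) 1, z₀ + t • (z - z₀) ∈ Metric.ball z₀ ρ := fun t ht =>
    (convex_ball z₀ ρ).add_smul_sub_mem (Metric.mem_ball_self hpos) hz ht
  have hd : ∀ t ∈ Set.Icc (0 : ℝ) 1, HasDerivAt (fun t : ℝ => H (z₀ + t • (z - z₀)))
      (L (z₀ + t • (z - z₀)) (z - z₀)) t := fun t ht => by
    have h1 : HasDerivAt (fun t : ℝ => z₀ + t • (z - z₀)) (z - z₀) t := by
      simpa using ((hasDerivAt_id t).smul_const (z - z₀)).const_add z₀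
    exact (hH _ (hpath t ht)).comp_hasDerivAt t h1
  have := eq_zero_of_abs_deriv_le_mul_abs_self_of_eq_zero_right (K := C * ‖z - z₀‖)
    (fun t ht => (hd t ht).continuousAt.continuousWithinAt)
    (fun t ht => (hd t (Set.Ico_subset_Icc_self ht)).hasDerivWithinAt) (by simpa using h0)
    (fun t ht => by
      refine ((L _).le_opNorm _).trans ?_
      have := hC _ (hpath t (Set.Ico_subset_Icc_self ht))
      calc _ ≤ C * ‖H (z₀ + t • (z - z₀))‖ * ‖z - z₀‖ := by gcongr
        _ = _ := by ring) 1 (by simp)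
  simpa using this

variable [IsManifold 𝓘(ℂ, ℂ) ω M]

/-- The differentials of maps in a chart. -/
theorem exists_hasFDerivAt_comp_chartAt_symm {p : M} {z : ℂ} (hz : z ∈ (chartAt ℂ p).target) :
    ∃ D : ℂ →L[ℝ] ℂ, ∀ F : M → E n, DiffAt F ((chartAt ℂ p).symm z) →
      HasFDerivAt (F ∘ (chartAt ℂ p).symm) ((diff F ((chartAt ℂ p).symm z)).comp D) z := by
  have : IsManifold 𝓘(ℝ, ℂ) ∞ M := isManifold_real
  have : IsManifold 𝓘(ℝ, ℂ) 1 M := IsManifold.of_le (n := ∞) (by simp)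
  have h := (mdifferentiable_chart (I := 𝓘(ℝ, ℂ)) p).mdifferentiableAt_symm hz
  exact ⟨mfderiv 𝓘(ℝ, ℂ) 𝓘(ℝ, ℂ) (chartAt ℂ p).symm z, fun F hF =>
    (HasMFDerivAt.comp z hF.hasMFDerivAt h.hasMFDerivAt).hasFDerivAt⟩

/-- Two Darboux transforms with the same parameter that agree at a point agree. -/
theorem eq_of_darbouxPair_of_eq [ConnectedSpace M] {Q : QuadraticDifferential M} {r : ℝ}
    {f fc f₁ f₂ : M → E n} (h₁ : DarbouxPair Q r f fc f₁ Set.univ)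
    (h₂ : DarbouxPair Q r f fc f₂ Set.univ) {p₀ : M} (h0 : f₁ p₀ = f₂ p₀) : f₁ = f₂ := by
  have : IsManifold 𝓘(ℝ, ℂ) ∞ M := isManifold_real
  have cont : ∀ {g : M → E n}, SmoothOn g Set.univ → Continuous g := fun hg =>
    continuousOn_univ.1 (ContMDiffOn.continuousOn hg)
  have c₁ := cont h₁.2
  have c₂ := cont h₂.2
  have cf := cont h₁.1.1
  have hclosed : IsClosed {p | f₁ p = f₂ p} := isClosed_eq c₁ c₂
  have hopen : IsOpen {p | f₁ p = f₂ p} := by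
    refine isOpen_iff_mem_nhds.2 fun p hp => ?_
    set φ := chartAt ℂ p with hφ
    have hps : p ∈ φ.source := mem_chart_source ℂ p
    have hzt : φ p ∈ φ.target := φ.map_source hps
    have hsymm : ContinuousAt φ.symm (φ p) := φ.continuousAt_symm hzt
    have hfc : ContDiffAt ℝ ∞ (fc ∘ φ.symm) (φ p) := by
      have h1 : ContMDiffAt 𝓘(ℝ, ℂ) 𝓘(ℝ, ℂ) ∞ φ.symm (φ p) :=
        (contMDiffOn_chart_symm (x := p)).contMDiffAt (φ.open_target.mem_nhds hzt)
      have h2 : ContMDiffAt 𝓘(ℝ, ℂ) 𝓘(ℝ, E n) ∞ fc (φ.symm (φ p)) :=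
        ContMDiffOn.contMDiffAt h₁.1.2.1 Filter.univ_mem
      exact (h2.comp (φ p) h1).contDiffAt
    have hfd : ContinuousAt (fderiv ℝ (fc ∘ φ.symm)) (φ p) :=
      (hfc.fderiv_right (m := 0) (by simp)).continuousAt
    -- The factor in `‖d(f₁ - f₂)‖ ≤ B ‖f₁ - f₂‖` in the chart; by continuity it is below `B (φ p) +
    -- 1` on a small ball.
    set B : ℂ → ℝ := fun z => |r| * (3 * (‖f₁ (φ.symm z) - f (φ.symm z)‖ +
      ‖f₂ (φ.symm z) - f (φ.symm z)‖) * ‖fderiv ℝ (fc ∘ φ.symm) z‖) with hB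
    have hBc : ContinuousAt B (φ p) := by
      have k : ∀ {g : M → E n}, Continuous g → ContinuousAt (fun z => g (φ.symm z)) (φ p) :=
        fun hg => hg.continuousAt.comp hsymm
      exact continuousAt_const.mul ((continuousAt_const.mul
        (((k c₁).sub (k cf)).norm.add ((k c₂).sub (k cf)).norm)).mul hfd.norm)
    have hev : ∀ᶠ z in nhds (φ p), z ∈ φ.target ∧ B z < B (φ p) + 1 :=
      (φ.open_target.eventually_mem hzt).and (hBc.eventually_lt_const (lt_add_one _))
    obtain ⟨ρ, hρ, hball⟩ := Metric.eventually_nhds_iff_ball.1 hev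
    have da : ∀ {g : M → E n} (q : M), SmoothOn g Set.univ → DiffAt g q := fun q hg =>
      hg.diffAt isOpen_univ (Set.mem_univ q)
    have hzero : ∀ z ∈ Metric.ball (φ p) ρ, f₁ (φ.symm z) - f₂ (φ.symm z) = 0 := by
      intro z hz
      refine eq_zero_on_ball_of_norm_fderiv_le (H := (fun q => f₁ q - f₂ q) ∘ φ.symm)
        (C := B (φ p) + 1)
        (L := fderiv ℝ ((fun q => f₁ q - f₂ q) ∘ φ.symm)) (fun z hz => ?_) (fun z hz => ?_)
        (by rw [Function.comp_apply, φ.left_inv hps]; exact sub_eq_zero.2 hp) hz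
      · obtain ⟨D, hD⟩ := exists_hasFDerivAt_comp_chartAt_symm (n := n) (hball z hz).1
        exact (hD _ ((da _ h₁.2).sub (da _ h₂.2))).differentiableAt.hasFDerivAt
      obtain ⟨hzt, hBz⟩ := hball z hz
      obtain ⟨D, hD⟩ := exists_hasFDerivAt_comp_chartAt_symm (n := n) hzt
      have hfcz := (hD _ (da _ h₁.1.2.1)).fderiv
      refine (ContinuousLinearMap.opNorm_le_bound _ (by positivity) fun ζ => ?_).trans
        (mul_le_mul_of_nonneg_right hBz.le (norm_nonneg _))
      rw [(hD _ ((da _ h₁.2).sub (da _ h₂.2))).fderiv, ContinuousLinearMap.comp_apply, diff_sub (da _ h₁.2) (da _ h₂.2), h₁.4 _ (Set.mem_univ _),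
        h₂.4 _ (Set.mem_univ _), ← smul_sub, norm_smul, Real.norm_eq_abs]
      have e := norm_sandwich_sub_sandwich_le (f₁ (φ.symm z) - f (φ.symm z))
        (f₂ (φ.symm z) - f (φ.symm z)) (fderiv ℝ (fc ∘ φ.symm) z ζ)
      rw [sub_sub_sub_cancel_right, hfcz, ContinuousLinearMap.comp_apply] at e
      have e2 := (fderiv ℝ (fc ∘ φ.symm) z).le_opNorm ζ
      nth_rewrite 1 [hfcz] at e2
      rw [ContinuousLinearMap.comp_apply] at e2
      calc _ ≤ |r| * (3 * (‖f₁ (φ.symm z) - f (φ.symm z)‖ + ‖f₂ (φ.symm z) - f (φ.symm z)‖) *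
              (‖fderiv ℝ (fc ∘ φ.symm) z‖ * ‖ζ‖) * ‖f₁ (φ.symm z) - f₂ (φ.symm z)‖) := by
            refine mul_le_mul_of_nonneg_left (e.trans ?_) (abs_nonneg r)
            gcongr
        _ = _ := by simp only [hB, Function.comp_apply]; ring
    have hnhds : φ.source ∩ φ ⁻¹' Metric.ball (φ p) ρ ∈ nhds p :=
      (φ.isOpen_inter_preimage Metric.isOpen_ball).mem_nhds ⟨hps, Metric.mem_ball_self hρ⟩
    filter_upwards [hnhds] with q hq
    have := hzero _ hq.2
    rw [φ.left_inv hq.1] at this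
    exact sub_eq_zero.1 this
  have huniv := IsClopen.eq_univ ⟨hclosed, hopen⟩ ⟨p₀, h0⟩
  funext p
  exact (huniv ▸ Set.mem_univ p : p ∈ {p | f₁ p = f₂ p})

end Unique

/-! ### The domain of the fourth surface -/

section Domain

variable {n : ℕ} {M : Type*}

theorem bianchiDenom_eq (r₁ r₂ : ℝ) (f f₁ f₂ : M → E n) (p : M) :
    bianchiDenom r₁ r₂ f f₁ f₂ p = vec (bianchiVec r₁ r₂ (f₁ p - f p) (f₂ p - f p)) := by
  rw [bianchiDenom, bianchiVec, vec_sub, vec_smul, vec_smul, vinv_eq, vinv_eq]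

theorem bianchiDomain_eq (r₁ r₂ : ℝ) (f f₁ f₂ : M → E n) :
    bianchiDomain r₁ r₂ f f₁ f₂ =
      {p | f₁ p ≠ f₂ p} ∩ {p | bianchiVec r₁ r₂ (f₁ p - f p) (f₂ p - f p) ≠ 0} := by
  ext p
  simp only [bianchiDomain, bianchiDenom_eq, ne_eq, vec_eq_zero, Set.mem_ofPred_eq, Set.mem_inter_iff]

theorem dense_setOf_not_of_not_eventually [TopologicalSpace M] {P : M → Prop}
    (h : ∀ p, ¬ ∀ᶠ q in nhds p, P q) : Dense {p | ¬ P p} := by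
  intro p
  rw [mem_closure_iff_frequently]
  exact Filter.not_eventually.1 (h p)

variable [TopologicalSpace M] [ChartedSpace ℂ M]
  {Q : QuadraticDifferential M} {r₁ r₂ : ℝ} {f fc f₁ f₂ : M → E n}

/-- If `w` vanishes near `p`, then `b = (r₂ / r₁) a`, and `dw = 0` becomes `(r₂ - r₂ ^ 2 / r₁) a df
a = 0`, which is impossible for an immersion. -/
theorem not_eventually_bianchiVec_eq_zero (hr₁ : r₁ ≠ 0) (hr₂ : r₂ ≠ 0) (hr : r₁ ≠ r₂)
    (hf : IsConformalImmersionOn f Set.univ) (h₁ : DarbouxPair Q r₁ f fc f₁ Set.univ)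
    (h₂ : DarbouxPair Q r₂ f fc f₂ Set.univ) (p : M) :
    ¬ ∀ᶠ q in nhds p, bianchiVec r₁ r₂ (f₁ q - f q) (f₂ q - f q) = 0 := by
  intro h
  have hp := Set.mem_univ p
  have hx : diff f p 1 ≠ 0 := fun h => one_ne_zero ((hf.2 p hp).1 (h.trans (map_zero _).symm))
  have e : (fun q => bianchiVec r₁ r₂ (f₁ q - f q) (f₂ q - f q)) =ᶠ[nhds p] fun _ => (0 : E n) := h
  have hd : diff (fun q => bianchiVec r₁ r₂ (f₁ q - f q) (f₂ q - f q)) p 1 = 0 := by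
    have := (e.mfderiv_eq (I := 𝓘(ℝ, ℂ)) (I' := 𝓘(ℝ, E n))).trans mfderiv_const
    exact congrArg (fun L : ℂ →L[ℝ] E n => L 1) this
  rw [diff_bianchiVec isOpen_univ h₁ h₂ hp] at hd
  have h0 : r₂ • vecInv (f₁ p - f p) - r₁ • vecInv (f₂ p - f p) = 0 := h.self_of_nhds
  have hb : vecInv (f₂ p - f p) = (r₁⁻¹ * r₂) • vecInv (f₁ p - f p) := by
    rw [mul_smul, sub_eq_zero.1 h0, smul_smul, inv_mul_cancel₀ hr₁, one_smul]
  rw [hb, smul_sandwich, smul_smul, ← sub_smul, smul_eq_zero] at hd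
  rcases hd with hd | hd
  · field_simp at hd
    rw [mul_zero, mul_eq_zero, sub_eq_zero] at hd
    exact hd.elim hr₂ hr
  · refine hx (sandwich_injective (by simpa using h₁.3 p hp) (hd.trans ?_))
    simp [sandwich]

theorem isOpen_bianchiDomain (h₁ : DarbouxPair Q r₁ f fc f₁ Set.univ)
    (h₂ : DarbouxPair Q r₂ f fc f₂ Set.univ) : IsOpen (bianchiDomain r₁ r₂ f f₁ f₂) := by
  have cont : ∀ {g : M → E n}, SmoothOn g Set.univ → Continuous g := fun hg =>
    continuousOn_univ.1 (ContMDiffOn.continuousOn hg)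
  rw [bianchiDomain_eq]
  exact (isOpen_ne_fun (cont h₁.2) (cont h₂.2)).inter
    (isOpen_ne_fun (cont (smoothOn_bianchiVec h₁ h₂)) continuous_const)

variable [ConnectedSpace M] [IsManifold 𝓘(ℂ, ℂ) ω M]

/-- Where `f₁ = f₂` on an open set, the two Riccati equations give `(r₁ - r₂) g dfc g = 0`, so `dfc
= 0` and `Q` vanishes there, hence everywhere. -/
theorem not_eventually_eq (hQ : ∃ p, Q.form p ≠ 0) (hr : r₁ ≠ r₂)
    (h₁ : DarbouxPair Q r₁ f fc f₁ Set.univ) (h₂ : DarbouxPair Q r₂ f fc f₂ Set.univ) (p : M) :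
    ¬ ∀ᶠ q in nhds p, f₁ q = f₂ q := by
  intro h
  obtain ⟨p', hp'⟩ := hQ
  refine hp' (Q.form_eq_zero_of_eventually (p₀ := p) ?_ p')
  filter_upwards [eventually_eventually_nhds.2 h] with q hq
  have hqu := Set.mem_univ q
  have hfc : ∀ X, diff fc q X = 0 := fun X => by
    have hd : diff f₁ q X = diff f₂ q X :=
      congrArg (fun L : ℂ →L[ℝ] E n => L X)
        (Filter.EventuallyEq.mfderiv_eq (I := 𝓘(ℝ, ℂ)) (I' := 𝓘(ℝ, E n)) hq)
    rw [h₁.4 q hqu, h₂.4 q hqu, hq.self_of_nhds, ← sub_eq_zero, ← sub_smul, smul_eq_zero] at hd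
    refine sandwich_injective (h₂.3 q hqu) ((hd.resolve_left (sub_ne_zero.2 hr)).trans ?_)
    simp [sandwich]
  refine Q.form_eq_zero_of_apply_eq_zero (X := 1) one_ne_zero ?_
  have h2 := (h₁.1.2.2 q hqu).2 1
  simp only [twoZeroPart, hfc, inner_zero_right] at h2
  rw [QuadraticDifferential.eval] at h2
  rw [← h2]
  simp

theorem dense_bianchiDomain (hQ : ∃ p, Q.form p ≠ 0) (hr₁ : r₁ ≠ 0) (hr₂ : r₂ ≠ 0)
    (hf : IsConformalImmersionOn f Set.univ) (h₁ : DarbouxPair Q r₁ f fc f₁ Set.univ)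
    (h₂ : DarbouxPair Q r₂ f fc f₂ Set.univ) (hne : f₁ ≠ f₂) :
    Dense (bianchiDomain r₁ r₂ f f₁ f₂) := by
  rw [bianchiDomain_eq]
  -- For equal parameters, `f₁` and `f₂` differ everywhere by uniqueness, and `bianchiVec` is `r₁
  -- (g₁⁻¹ - g₂⁻¹)`, so both conditions hold at every point.
  by_cases hr : r₁ = r₂
  · subst hr
    have hne' : ∀ p, f₁ p ≠ f₂ p := fun p hp => hne (eq_of_darbouxPair_of_eq h₁ h₂ hp)
    convert dense_univ
    refine Set.eq_univ_of_forall fun p => ⟨hne' p, fun h => hne' p ?_⟩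
    rw [bianchiVec, ← smul_sub, smul_eq_zero_iff_right hr₁, sub_eq_zero,
      vecInv_injective.eq_iff, sub_left_inj] at h
    exact h
  · have cont : ∀ {g : M → E n}, SmoothOn g Set.univ → Continuous g := fun hg =>
      continuousOn_univ.1 (ContMDiffOn.continuousOn hg)
    exact (dense_setOf_not_of_not_eventually (not_eventually_eq hQ hr h₁ h₂)).inter_of_isOpen_left
      (dense_setOf_not_of_not_eventually (not_eventually_bianchiVec_eq_zero hr₁ hr₂ hr hf h₁ h₂))
      (isOpen_ne_fun (cont h₁.2) (cont h₂.2))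

end Domain

/-! ### The closed formula for the fourth surface. -/

section Formula

variable {n : ℕ} {M : Type*} {r₁ r₂ : ℝ} {f f₁ f₂ : M → E n}

/-- Since `fᵢ gᵢ⁻¹ = 1 + f gᵢ⁻¹`, the numerator is `f w + (r₂ - r₁)`. -/
theorem vec_bianchiMap {p : M} (h₁ : f₁ p - f p ≠ 0) (h₂ : f₂ p - f p ≠ 0)
    (hw : bianchiVec r₁ r₂ (f₁ p - f p) (f₂ p - f p) ≠ 0) :
    vec (bianchiMap r₁ r₂ f f₁ f₂ p) =
      (r₂ • (vec (f₁ p) * vinv (f₁ p - f p)) - r₁ • (vec (f₂ p) * vinv (f₂ p - f p)))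
        * Ring.inverse (vec (bianchiVec r₁ r₂ (f₁ p - f p) (f₂ p - f p))) := by
  have k : ∀ {g : E n}, g - f p ≠ 0 →
      vec g * vinv (g - f p) = 1 + vec (f p) * vec (vecInv (g - f p)) := fun {g} hg => by
    rw [vinv_eq, ← vec_mul_vec_vecInv hg, ← add_mul, ← vec_add, sub_add_cancel]
  have e : r₂ • (vec (f₁ p) * vinv (f₁ p - f p)) - r₁ • (vec (f₂ p) * vinv (f₂ p - f p)) =
      vec (f p) * vec (bianchiVec r₁ r₂ (f₁ p - f p) (f₂ p - f p)) + (r₂ - r₁) • (1 : Cl n) := by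
    rw [k h₁, k h₂, bianchiVec, vec_sub, vec_smul, vec_smul, mul_sub, mul_smul_comm, mul_smul_comm]
    module
  rw [e, ringInverse_vec, add_mul, mul_assoc, vec_mul_vec_vecInv hw, mul_one, smul_mul_assoc,
    one_mul, bianchiMap, bianchiStep, vec_add, vec_smul]

end Formula

end Isothermic

end

/-! ### The permutability theorem. -/

theorem mainTheorem1 {M : Type*} [TopologicalSpace M] [T2Space M] [ConnectedSpace M]
    [ChartedSpace ℂ M] [IsManifold 𝓘(ℂ, ℂ) ω M]
    (Q : Isothermic.QuadraticDifferential M) (hQ : ∃ p, Q.form p ≠ 0)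
    {n : ℕ} (f f₁ f₂ : M → Isothermic.E n) (r₁ r₂ : ℝ) (hr₁ : r₁ ≠ 0) (hr₂ : r₂ ≠ 0)
    (hf : Isothermic.IsIsothermicOn Q f Set.univ)
    (hf₁ : Isothermic.IsDarbouxOn Q r₁ f f₁ Set.univ)
    (hf₂ : Isothermic.IsDarbouxOn Q r₂ f f₂ Set.univ)
    (hne : f₁ ≠ f₂) :
    IsOpen (Isothermic.bianchiDomain r₁ r₂ f f₁ f₂) ∧
    Dense (Isothermic.bianchiDomain r₁ r₂ f f₁ f₂) ∧
    ∃ fhat : M → Isothermic.E n,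
      Isothermic.IsIsothermicOn Q fhat (Isothermic.bianchiDomain r₁ r₂ f f₁ f₂) ∧
      Isothermic.IsDarbouxOn Q r₂ f₁ fhat (Isothermic.bianchiDomain r₁ r₂ f f₁ f₂) ∧
      Isothermic.IsDarbouxOn Q r₁ f₂ fhat (Isothermic.bianchiDomain r₁ r₂ f f₁ f₂) ∧
      ∀ p ∈ Isothermic.bianchiDomain r₁ r₂ f f₁ f₂,
        Isothermic.vec (fhat p) =
          (r₂ • (Isothermic.vec (f₁ p) * Isothermic.vinv (f₁ p - f p))
              - r₁ • (Isothermic.vec (f₂ p) * Isothermic.vinv (f₂ p - f p)))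
            * Ring.inverse (Isothermic.bianchiDenom r₁ r₂ f f₁ f₂ p) ∧
        Isothermic.Concircular {f p, f₁ p, fhat p, f₂ p} ∧
        Isothermic.crossRatio (f p) (f₁ p) (fhat p) (f₂ p) =
          algebraMap ℝ (Isothermic.Cl n) (r₂ / r₁) := by
  obtain ⟨fc, h₁⟩ := hf₁.exists_darbouxPair isOpen_univ
  obtain ⟨fc', h₂'⟩ := hf₂.exists_darbouxPair isOpen_univ
  -- The two Darboux transforms may come with different Christoffel transforms of `f`; the second is
  -- moved to the first one's.
  have h₂ := h₂'.change_christoffel hf.1 h₁.1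
  have hU := Isothermic.isOpen_bianchiDomain h₁ h₂
  have mem : ∀ p ∈ Isothermic.bianchiDomain r₁ r₂ f f₁ f₂, f₁ p ≠ f₂ p ∧
      Isothermic.bianchiVec r₁ r₂ (f₁ p - f p) (f₂ p - f p) ≠ 0 := fun p hp => by
    rwa [Isothermic.bianchiDomain_eq] at hp
  have h₁U := h₁.mono (Set.subset_univ (Isothermic.bianchiDomain r₁ r₂ f f₁ f₂))
  have h₂U := h₂.mono (Set.subset_univ (Isothermic.bianchiDomain r₁ r₂ f f₁ f₂))
  have d₁ := Isothermic.darbouxPair_bianchiMap hU hr₁ h₁U h₂U (fun p hp => (mem p hp).1)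
    (fun p hp => (mem p hp).2)
  have d₂ := Isothermic.darbouxPair_bianchiMap hU hr₂ h₂U h₁U (fun p hp => (mem p hp).1.symm)
    (fun p hp => by rw [Isothermic.bianchiVec_swap, neg_ne_zero]; exact (mem p hp).2)
  rw [Isothermic.bianchiMap_swap] at d₂
  refine ⟨hU, Isothermic.dense_bianchiDomain hQ hr₁ hr₂ hf.1 h₁ h₂ hne,
    Isothermic.bianchiMap r₁ r₂ f f₁ f₂, ⟨?_, _, d₁.isChristoffelOn_darbouxDual hU hr₂⟩,
    d₁.isDarbouxOn hU, d₂.isDarbouxOn hU, fun p hp => ?_⟩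
  -- The differential of the fourth surface arises from `df` by two successive similarities, through
  -- the Christoffel transform of `f₁`; `f₁` itself need not be immersed.
  · exact d₁.isConformalImmersionOn hr₂ (h₁U.isConformalImmersionOn_darbouxDual hU hr₁
      (hf.1.mono (Set.subset_univ _)))
  · obtain ⟨hne', hw⟩ := mem p hp
    have n₁ := h₁U.ne p hp
    have n₂ := h₂U.ne p hp
    have hg : f₁ p - f p ≠ f₂ p - f p := fun h => hne' (sub_left_injective h)
    refine ⟨?_, ?_, ?_⟩
    · rw [Isothermic.bianchiDenom_eq]
      exact Isothermic.vec_bianchiMap n₁ n₂ hw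
    · have := Isothermic.concircular_bianchiStep (f p) n₁ n₂ hg hw
      rwa [add_sub_cancel, add_sub_cancel] at this
    · have := Isothermic.crossRatio_bianchiStep (f p) hr₁ n₁ n₂ hg hw
      rwa [add_sub_cancel, add_sub_cancel] at this
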